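/- Let $(M_1,\alpha_1)$ and $(M_2,\alpha_2)$ be smooth finite-dimensional Riemannian manifolds without boundary, $M=M_1\times M_2$, $n=\dim M$. Let $f:[0,\infty)\times[0,\infty)\to[0,\infty)$ be $C^\infty$ away from the origin (up to the boundary of the quadrant), with $f(\lambda s,\lambda t)=\lambda f(s,t)$ for $\lambda>0$ and $f(s,t)\neq 0$ for $(s,t)\ne(0,0)$. On $TM$ put $$F(x,y)=\sqrt{f\big(\alpha_1(x_1,y_1)^2,\ \alpha_2(x_2,y_2)^2\big)},\qquad x=(x_1,x_2),\quad y=y_1\oplus y_2 .$$ Notation, for a function $F$ on $TM$ that is positively homogeneous of degree one and smooth off the zero section: $g_{ij}=\frac12[F^2]_{y^iy^j}$ is the fundamental tensor, $\mathbf g_y$ the bilinear form $g_{ij}(x,y)u^iv^j$; $F$ is a Finsler metric if moreover $F\ge 0$, $F=0$ only on zero vectors, and $\mathbf g_y$ is positive definite for all $y\neq0$. $G^i=\frac14 g^{il}([F^2]_{x^ky^l}y^k-[F^2]_{x^l})$ are the spray coefficients; $F$ is Berwald if $G^i(x,y)$ is quadratic in $y$ for every $x$. The Riemann tensor $\mathbf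 R_y:T_xM\to T_xM$ has coefficients $$R^i_{\ k}=2\frac{\partial G^i}{\partial x^k}-y^j\frac{\partial^2G^i}{\partial x^j\partial y^k}+2G^j\frac{\partial^2G^i}{\partial y^j\partial y^k}-\frac{\partial G^i}{\partial y^j}\frac{\partial G^j}{\partial y^k},$$ and the flag curvature of $P=\mathrm{span}\{y,u\}$ is $\mathbf K(P,y)=\mathbf g_y(\mathbf R_y(u),u)/(\mathbf g_y(y,y)\mathbf g_y(u,u)-\mathbf g_y(y,u)^2)$. The distortion is $\tau=\ln(\sqrt{\det(g_{ij})}/\sigma_F)$, where $\sigma_F(x)$ is the volume of the Euclidean unit ball of $\mathbb R^n$ divided by that of $\{(y^i)\in\mathbb R^n: F(x,y^i\partial_i)<1\}$; $I_i=\partial\tau/\partial y^i$ is the mean Cartan tensor and $\mathbf I_y=g^{il}I_l\,\partial_i$; the S-curvature $\mathbf S(x,y)$ is the derivative of $\tau$ along the geodesic flow; the mean Landsberg tensor is $J_k=L^m_{\ km}$ with $L^i_{\ kl}=\partial^2G^i/\partial y^k\partial y^l-\Gamma^i_{kl}$, $\Gamma^i_{kl}$ the Chern connection coefficients. **Theorem.**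 1. If $M_1,M_2$ are nonempty of positive dimension, then $(g_{ij})$ is positive definite at all $y\ne0$ if and only if, for all $(s,t)\neq(0,0)$ with $s,t\ge0$, $$f_s>0,\quad f_t>0,\quad f_s+2sf_{ss}>0,\quad f_t+2tf_{tt}>0,\quad f_sf_t-2ff_{st}>0.\qquad(*)$$ Assume $(*)$ from now on. Then the following hold. 2. $F$ is a Finsler metric, its spray coefficients in product coordinates are the direct sum of those of $\alpha_1$ and $\alpha_2$, and $F$ is a Berwald metric. 3. The Riemann tensor splits: $\mathbf R_y(v_1\oplus v_2)=\mathbf R^{\alpha_1}_{y_1}(v_1)\oplus\mathbf R^{\alpha_2}_{y_2}(v_2)$ for all $y=y_1\oplus y_2\ne0$. 4. If $\alpha_1$ and $\alpha_2$ both have nonpositive sectional curvature, then $F$ has nonpositive flag curvature, $\mathbf K\le0$. 5. In all cases $\mathbf g_y(\mathbf R_y(\mathbf I_y),\mathbf I_y)=0$ for all $y\neq0$. 6. $\mathbf S=0$. Consequently, if $M_1$ and $M_2$ are compact and $\alpha_1,\alpha_2$ have nonpositive sectional curvature, then $(M,F)$ is a compact boundaryless Finsler manifold with constant S-curvature ($\mathbf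 S=(n+1)cF$ for a constant $c$) and $\mathbf K\le0$. 7. In all cases the mean Landsberg curvature vanishes, $\mathbf J=0$, and whenever $\mathbf I_y\neq0$ the vectors $y,\mathbf I_y$ span a plane $P$ with $\mathbf K(P,y)=0$. -/

import Mathlib

open scoped Manifold ContDiff

set_option maxSynthPendingDepth 3

noncomputable section

namespace Finsler

/-! ### Finsler geometry in a coordinate domain

`L p v` is the coordinate expression of a Finsler function: `p` is a point of the model vector
space `E` and `v` a tangent vector at `p`.  All formulas are the usual index formulas, written
without indices. -/

section Coordinates

variable {E : Type*} [NormedAddCommGroup E] [NormedSpace ℝ E]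

/-- The fundamental tensor `g_{ij} = (1/2) [F^2]_{y^i y^j}` as a bilinear form. -/
def fundCoord (L : E → E → ℝ) (p v : E) : E →L[ℝ] E →L[ℝ] ℝ :=
  (1 / 2 : ℝ) • fderiv ℝ (fderiv ℝ (fun w => L p w ^ 2)) v

/-- The vector `B^{ij} ξ_j` obtained from a covector `ξ` with a nondegenerate symmetric form `B`:
the unique `u` with `B u w = ξ w` for all `w`. -/
def raise (B : E →L[ℝ] E →L[ℝ] ℝ) (ξ : E →L[ℝ] ℝ) : E :=
  ContinuousLinearMap.inverse B ξ

/-- The spray coefficients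
`G^i = (1/4) g^{il} ([F^2]_{x^k y^l} y^k - [F^2]_{x^l})`; geodesics are the solutions of
`σ'' + 2 G(σ, σ') = 0`. -/
def sprayCoord (L : E → E → ℝ) (p v : E) : E :=
  raise (fundCoord L p v)
    ((1 / 4 : ℝ) • (fderiv ℝ (fun q => fderiv ℝ (fun w => L q w ^ 2) v) p v
      - fderiv ℝ (fun q => L q v ^ 2) p))

/-- The Riemann tensor `R^i_k = 2 ∂G^i/∂x^k - y^j ∂²G^i/∂x^j∂y^k + 2 G^j ∂²G^i/∂y^j∂y^k
- (∂G^i/∂y^j)(∂G^j/∂y^k)` as an endomorphism. -/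
def riemannCoord (L : E → E → ℝ) (p v : E) : E →L[ℝ] E :=
  (2 : ℝ) • fderiv ℝ (fun q => sprayCoord L q v) p
    - fderiv ℝ (fun q => fderiv ℝ (sprayCoord L q) v) p v
    + (2 : ℝ) • fderiv ℝ (fderiv ℝ (sprayCoord L p)) v (sprayCoord L p v)
    - (fderiv ℝ (sprayCoord L p) v).comp (fderiv ℝ (sprayCoord L p) v)

/-- `koszul H a b` is the covector `c ↦ (1/2) (H a b c + H b a c - H c a b)`. -/
def koszul (H : E →L[ℝ] E →L[ℝ] E →L[ℝ] ℝ) (a b : E) : E →L[ℝ] ℝ :=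
  (1 / 2 : ℝ) • (H a b + H b a - (H.flip a).flip b)

/-- The horizontal derivative of the fundamental tensor:
`(δg_{ij}/δx^k) = ∂g_{ij}/∂x^k - (∂G^m/∂y^k) ∂g_{ij}/∂y^m`, the first argument being `k`. -/
def horizontalDerivFund (L : E → E → ℝ) (p v : E) : E →L[ℝ] E →L[ℝ] E →L[ℝ] ℝ :=
  fderiv ℝ (fun q => fundCoord L q v) p
    - ContinuousLinearMap.comp (fderiv ℝ (fundCoord L p) v) (fderiv ℝ (sprayCoord L p) v)

/-- The Chern connection `Γ^i_{jk} = (1/2) g^{il} (δ_j g_{lk} + δ_k g_{lj} - δ_l g_{jk})`. -/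
def chernCoord (L : E → E → ℝ) (p v a b : E) : E :=
  raise (fundCoord L p v) (koszul (horizontalDerivFund L p v) a b)

/-- The Landsberg tensor.  For the Chern connection the coefficient of `- ω^k ∧ ω^{n+l}` in
`Ω^i = dω^{n+i} - ω^{n+j} ∧ ω_j^i` is `L^i_{kl} = ∂²G^i/∂y^k∂y^l - Γ^i_{kl}`. -/
def landsbergCoord (L : E → E → ℝ) (p v a b : E) : E :=
  fderiv ℝ (fderiv ℝ (sprayCoord L p)) v a b - chernCoord L p v a b

/-- The mean Landsberg tensor `J_k = L^m_{km}`. -/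
def meanLandsbergCoord [FiniteDimensional ℝ E] (L : E → E → ℝ) (p v : E) (a : E) : ℝ :=
  ∑ m, (Module.finBasis ℝ E).coord m (landsbergCoord L p v a (Module.finBasis ℝ E m))

/-- The density of the Finsler volume form: the volume of the Euclidean unit ball divided by the
volume of `{(y^i) ∈ ℝ^n | F(x, y^i ∂_i) < 1}`. -/
def volumeDensityCoord [FiniteDimensional ℝ E] (L : E → E → ℝ) (p : E) : ℝ :=
  (MeasureTheory.volume
      (Metric.ball (0 : EuclideanSpace ℝ (Fin (Module.finrank ℝ E))) 1)).toReal /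
    (MeasureTheory.volume
      {c : Fin (Module.finrank ℝ E) → ℝ | L p (∑ i, c i • Module.finBasis ℝ E i) < 1}).toReal

/-- The distortion `τ = ln (√(det g_{ij}) / σ_F)`. -/
def distortionCoord [FiniteDimensional ℝ E] (L : E → E → ℝ) (p v : E) : ℝ :=
  Real.log (Real.sqrt (Matrix.det (Matrix.of fun i j =>
      fundCoord L p v (Module.finBasis ℝ E i) (Module.finBasis ℝ E j))) /
    volumeDensityCoord L p)

/-- The mean Cartan tensor `I_i = ∂τ/∂y^i`. -/
def meanCartanCoord [FiniteDimensional ℝ E] (L : E → E → ℝ) (p v : E) : E →L[ℝ] ℝ :=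
  fderiv ℝ (distortionCoord L p) v

/-- The S-curvature: the derivative of the distortion along the geodesic flow, that is, along a
lifted geodesic `(σ, σ')`, whose velocity at `(p, v)` is `(v, -2 G(p, v))`. -/
def sCurvatureCoord [FiniteDimensional ℝ E] (L : E → E → ℝ) (p v : E) : ℝ :=
  fderiv ℝ (fun z : E × E => distortionCoord L z.1 z.2) (p, v) (v, -(2 : ℝ) • sprayCoord L p v)

/-! Riemannian metrics in coordinates. -/

/-- The Christoffel symbols of the Levi-Civita connection of `γ`. -/
def christoffelCoord (γ : E → E →L[ℝ] E →L[ℝ] ℝ) (p a b : E) : E :=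
  raise (γ p) (koszul (fderiv ℝ γ p) a b)

/-- The curvature tensor `R(a, b)c = ∇_a ∇_b c - ∇_b ∇_a c` (`a`, `b`, `c` constant in the
coordinates) of the Levi-Civita connection of `γ`. -/
def curvatureCoord (γ : E → E →L[ℝ] E →L[ℝ] ℝ) (p a b c : E) : E :=
  fderiv ℝ (fun q => christoffelCoord γ q b c) p a
    - fderiv ℝ (fun q => christoffelCoord γ q a c) p b
    + christoffelCoord γ p a (christoffelCoord γ p b c)
    - christoffelCoord γ p b (christoffelCoord γ p a c)

end Coordinates

/-! ### Finsler geometry on a manifold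

A function `F` on the tangent bundle is a family of functions `F x` on the tangent spaces. The
quantities at `y ∈ T_x M` are computed in the preferred chart at `x`, in which `T_x M` is `E`. -/

section Manifold

variable {E : Type*} [NormedAddCommGroup E] [NormedSpace ℝ E] {H : Type*} [TopologicalSpace H]
  (I : ModelWithCorners ℝ E H) {M : Type*} [TopologicalSpace M] [ChartedSpace H M]

/-- The expression of `F` in the chart centred at `c`. -/
def inChart (F : ∀ x : M, TangentSpace I x → ℝ) (c : M) (p v : E) : ℝ :=
  F ((extChartAt I c).symm p) (mfderiv 𝓘(ℝ, E) I (extChartAt I c).symm p v)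

variable (F : ∀ x : M, TangentSpace I x → ℝ)

/-- The bilinear form `g_y` on `T_x M`. -/
def fundamentalTensor (x : M) (y : TangentSpace I x) :
    TangentSpace I x →L[ℝ] TangentSpace I x →L[ℝ] ℝ :=
  fundCoord (E := E) (inChart I F x) (extChartAt I x x) y

/-- The spray coefficients `G(x, y)`, in the chart at `x`. -/
def spray (x : M) (y : TangentSpace I x) : TangentSpace I x :=
  sprayCoord (E := E) (inChart I F x) (extChartAt I x x) y

/-- The Riemann curvature `R_y : T_x M → T_x M`. -/
def riemann (x : M) (y : TangentSpace I x) : TangentSpace I x →L[ℝ] TangentSpace I x :=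
  riemannCoord (E := E) (inChart I F x) (extChartAt I x x) y

/-- The flag curvature `K(P, y)` for `P = span {y, u}`. -/
def flagCurvature (x : M) (y u : TangentSpace I x) : ℝ :=
  fundamentalTensor I F x y (riemann I F x y u) u /
    (fundamentalTensor I F x y y y * fundamentalTensor I F x y u u
      - fundamentalTensor I F x y y u ^ 2)

/-- `K ≤ 0`, for all flags. -/
def NonposFlagCurvature : Prop :=
  ∀ (x : M) (y u : TangentSpace I x), LinearIndependent ℝ ![y, u] → flagCurvature I F x y u ≤ 0

/-- A Finsler metric: a nonnegative function on `TM`, vanishing only on zero vectors, smooth off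
the zero section, positively homogeneous of degree one, with positive definite fundamental
tensor. -/
structure IsFinslerMetric [IsManifold I ∞ M] : Prop where
  nonneg : ∀ (x : M) (y : TangentSpace I x), 0 ≤ F x y
  eq_zero_iff : ∀ (x : M) (y : TangentSpace I x), F x y = 0 ↔ y = 0
  homogeneous : ∀ (x : M) (y : TangentSpace I x) (r : ℝ), 0 < r → F x (r • y) = r * F x y
  smooth : ContMDiffOn I.tangent 𝓘(ℝ, ℝ) ∞ (fun z : TangentBundle I M => F z.proj z.snd)
    {z | z.snd ≠ 0}
  posDef : ∀ (x : M) (y u : TangentSpace I x), y ≠ 0 → u ≠ 0 → 0 < fundamentalTensor I F x y u u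

/-- A Berwald metric: at every point the spray coefficients `G^i = (1/2) Γ^i_{jk}(x) y^j y^k` are
quadratic in `y`. -/
def IsBerwald : Prop :=
  ∀ x : M, ∃ Γ : TangentSpace I x →ₗ[ℝ] TangentSpace I x →ₗ[ℝ] TangentSpace I x,
    ∀ y : TangentSpace I x, y ≠ 0 → spray I F x y = (1 / 2 : ℝ) • Γ y y

variable [FiniteDimensional ℝ E]

/-- The mean Cartan torsion vector `I_y = g^{il} I_l ∂_i`. -/
def meanCartan (x : M) (y : TangentSpace I x) : TangentSpace I x :=
  raise (E := E) (fundCoord (inChart I F x) (extChartAt I x x) y)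
    (meanCartanCoord (E := E) (inChart I F x) (extChartAt I x x) y)

/-- The mean Landsberg tensor `u ↦ J_k u^k`. -/
def meanLandsberg (x : M) (y u : TangentSpace I x) : ℝ :=
  meanLandsbergCoord (E := E) (inChart I F x) (extChartAt I x x) y u

/-- The S-curvature. -/
def sCurvature (x : M) (y : TangentSpace I x) : ℝ :=
  sCurvatureCoord (E := E) (inChart I F x) (extChartAt I x x) y

/-- Constant S-curvature `S = (n + 1) c F`. -/
def HasConstantSCurvature (c : ℝ) : Prop :=
  ∀ (x : M) (y : TangentSpace I x), y ≠ 0 →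
    sCurvature I F x y = ((Module.finrank ℝ E : ℝ) + 1) * c * F x y

/-- `(M, F)` is a compact Finsler manifold without boundary, of constant S-curvature and
nonpositive flag curvature. -/
structure IsCompactNonposConstantS [IsManifold I ∞ M] : Prop where
  compact : CompactSpace M
  boundaryless : BoundarylessManifold I M
  finsler : IsFinslerMetric I F
  constantS : ∃ c : ℝ, HasConstantSCurvature I F c
  nonpos : NonposFlagCurvature I F

/-- The mean Landsberg curvature vanishes, and `K(P, y) = 0` for `P = span {y, I_y}` whenever
`I_y ≠ 0` (in which case `y`, `I_y` do span a plane). -/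
structure HasRigidity : Prop where
  meanLandsberg_eq_zero : ∀ (x : M) (y u : TangentSpace I x), y ≠ 0 → meanLandsberg I F x y u = 0
  linearIndependent : ∀ (x : M) (y : TangentSpace I x), y ≠ 0 → meanCartan I F x y ≠ 0 →
    LinearIndependent ℝ ![y, meanCartan I F x y]
  flagCurvature_eq_zero : ∀ (x : M) (y : TangentSpace I x), y ≠ 0 → meanCartan I F x y ≠ 0 →
    flagCurvature I F x y (meanCartan I F x y) = 0

end Manifold

/-! ### Riemannian metrics -/

section Riemannian

variable {E : Type*} [NormedAddCommGroup E] [NormedSpace ℝ E] {H : Type*} [TopologicalSpace H]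
  {I : ModelWithCorners ℝ E H} {M : Type*} [TopologicalSpace M] [ChartedSpace H M]
  [IsManifold I ∞ M]

/-- The norm `α(x, y) = √(g_x(y, y))` of a Riemannian metric `g`. -/
def riemannianNorm (g : Bundle.ContMDiffRiemannianMetric I ∞ E (fun x : M => TangentSpace I x))
    (x : M) (y : TangentSpace I x) : ℝ :=
  Real.sqrt (g.inner x y y)

/-- The metric `g` in the chart centred at `c`. -/
def metricInChart (g : Bundle.ContMDiffRiemannianMetric I ∞ E (fun x : M => TangentSpace I x))
    (c : M) (p : E) : E →L[ℝ] E →L[ℝ] ℝ :=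
  let A : E →L[ℝ] E := mfderiv 𝓘(ℝ, E) I (extChartAt I c).symm p
  let B : E →L[ℝ] E →L[ℝ] ℝ := g.inner ((extChartAt I c).symm p)
  B.bilinearComp A A

/-- The sectional curvature `g(R(u, v)v, u) / (g(u, u) g(v, v) - g(u, v)²)` of the plane spanned
by `u` and `v`. -/
def sectionalCurvature
    (g : Bundle.ContMDiffRiemannianMetric I ∞ E (fun x : M => TangentSpace I x))
    (x : M) (u v : TangentSpace I x) : ℝ :=
  g.inner x (curvatureCoord (E := E) (metricInChart g x) (extChartAt I x x) u v v) u /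
    (g.inner x u u * g.inner x v v - g.inner x u v ^ 2)

def NonposSectionalCurvature
    (g : Bundle.ContMDiffRiemannianMetric I ∞ E (fun x : M => TangentSpace I x)) : Prop :=
  ∀ (x : M) (u v : TangentSpace I x), LinearIndependent ℝ ![u, v] →
    sectionalCurvature g x u v ≤ 0

end Riemannian

/-! ### The product metrics -/

/-- The closed quadrant `[0, ∞) × [0, ∞)`. -/
def quadrant : Set (ℝ × ℝ) := {q | 0 ≤ q.1 ∧ 0 ≤ q.2}

/-- The partial derivative in the first variable on the closed quadrant (one-sided on the
boundary). -/
def partialS (f : ℝ × ℝ → ℝ) (q : ℝ × ℝ) : ℝ := fderivWithin ℝ f quadrant q (1, 0)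

/-- The partial derivative in the second variable on the closed quadrant. -/
def partialT (f : ℝ × ℝ → ℝ) (q : ℝ × ℝ) : ℝ := fderivWithin ℝ f quadrant q (0, 1)

/-- `f : [0, ∞)² → [0, ∞)` is smooth away from the origin, positively homogeneous of degree one,
and nonzero away from the origin. -/
structure IsHomogeneousProfile (f : ℝ × ℝ → ℝ) : Prop where
  nonneg : ∀ q ∈ quadrant, 0 ≤ f q
  smooth : ContDiffOn ℝ ∞ f (quadrant \ {0})
  homogeneous : ∀ q ∈ quadrant, ∀ r : ℝ, 0 < r → f (r • q) = r * f q
  ne_zero : ∀ q ∈ quadrant, q ≠ 0 → f q ≠ 0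

/-- `f_s > 0`, `f_t > 0`, `f_s + 2 s f_ss > 0`, `f_t + 2 t f_tt > 0` and `f_s f_t - 2 f f_st > 0`
away from the origin. -/
def ConvexityConditions (f : ℝ × ℝ → ℝ) : Prop :=
  ∀ q ∈ quadrant, q ≠ 0 →
    0 < partialS f q ∧ 0 < partialT f q ∧
    0 < partialS f q + 2 * q.1 * partialS (partialS f) q ∧
    0 < partialT f q + 2 * q.2 * partialT (partialT f) q ∧
    0 < partialS f q * partialT f q - 2 * f q * partialT (partialS f) q

section Product

variable {E₁ : Type*} [NormedAddCommGroup E₁] [NormedSpace ℝ E₁] {H₁ : Type*}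
  [TopologicalSpace H₁] {I₁ : ModelWithCorners ℝ E₁ H₁} {M₁ : Type*} [TopologicalSpace M₁]
  [ChartedSpace H₁ M₁] [IsManifold I₁ ∞ M₁]
  {E₂ : Type*} [NormedAddCommGroup E₂] [NormedSpace ℝ E₂] {H₂ : Type*}
  [TopologicalSpace H₂] {I₂ : ModelWithCorners ℝ E₂ H₂} {M₂ : Type*} [TopologicalSpace M₂]
  [ChartedSpace H₂ M₂] [IsManifold I₂ ∞ M₂]

/-- `F = √(f(α₁², α₂²))` on `M₁ × M₂`; the tangent space at `(x₁, x₂)` is the product of the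
tangent spaces. -/
def productMetric (f : ℝ × ℝ → ℝ)
    (g₁ : Bundle.ContMDiffRiemannianMetric I₁ ∞ E₁ (fun x : M₁ => TangentSpace I₁ x))
    (g₂ : Bundle.ContMDiffRiemannianMetric I₂ ∞ E₂ (fun x : M₂ => TangentSpace I₂ x))
    (x : M₁ × M₂) (y : TangentSpace (I₁.prod I₂) x) : ℝ :=
  Real.sqrt (f (riemannianNorm g₁ x.1 y.1 ^ 2, riemannianNorm g₂ x.2 y.2 ^ 2))

end Product

end Finsler

end

noncomputable section

namespace Finsler

/-! ### Calculus of the profile on the closed quadrant -/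

section Profile

/-! The function `F^2` depends on a tangent vector only through the pair `(α₁², α₂²)`, and each
`α_i²` is preserved by parallel transport in its own factor. Write `Γ` for the direct sum of the two
families of Christoffel symbols. By metric compatibility, the derivative of any function of `(α₁²,
α₂²)` along a curve `(c, W)` in the tangent bundle involves only `W' + Γ(c', W)`
(`hasDerivAt_comp_normPair`). Applied to `F^2` and to its fibre differential, this gives `g_y` as an
explicit form and cancels everything in the spray formula except `(1/2) Γ(y, y)`
(`IsProductOn.sprayCoord_eq`). So the spray does not see `f`. It is quadratic, its Riemann tensor is
the curvature of `Γ` and hence splits, and the horizontal derivative of `g` is metric for the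
symmetric connection `Γ`. Thus `Γ` is the Chern connection and the Landsberg tensor vanishes.

For positive definiteness, `g_y(u, u)` is a quadratic expression in the inner products of `u` with
`y` and the lengths of `u` in each factor. Cauchy–Schwarz reduces it to a binary form whose
discriminant is, by Euler's relations, `f_s f_t - 2 f f_st` up to a positive factor
(`binary_form_pos`). Conversely, the inequalities come from particular test vectors, and `f_s, f_t >
0` from integrating the third and fourth inequalities (`convexityConditions`).

For curvature, `R(u, y)y` is orthogonal to `y` in each factor. Hence the second derivatives of `f`
drop out of `g_y(R_y(u), u)`, leaving a positive combination of the two Riemannian numerators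
(`fundCoord_riemannCoord_self`).

For the distortion, pairs of linear isometries of the factors carry tangent vectors with equal pairs
of lengths to one another and preserve `F`, even between different base points. So the distortion is
a function of `(α₁², α₂²)` alone (`distortionCoord_congr`). It is therefore constant along curves
with parallel velocity, which gives `S = 0`, and its fibre derivative kills vectors orthogonal to
both components of `y`. The latter forces `I_y = (c₁ y₁, c₂ y₂)`, on which the split Riemann tensor
vanishes. -/

lemma quadrant_eq_prod : quadrant = Set.Ici (0 : ℝ) ×ˢ Set.Ici (0 : ℝ) := by
  rfl

lemma uniqueDiffOn_quadrant : UniqueDiffOn ℝ quadrant := by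
  rw [quadrant_eq_prod]
  exact (uniqueDiffOn_Ici 0).prod (uniqueDiffOn_Ici 0)

/-- Boundary points are limits of interior points, which is what symmetry of second derivatives
within the closed quadrant requires. -/
lemma mem_closure_interior_quadrant {q : ℝ × ℝ} (hq : q ∈ quadrant) :
    q ∈ closure (interior quadrant) := by
  rw [quadrant_eq_prod] at hq ⊢
  rw [interior_prod_eq, interior_Ici, closure_prod_eq, closure_Ioi]
  exact hq

variable {h : ℝ × ℝ → ℝ} {q : ℝ × ℝ}

/-- Smoothness on the closed quadrant away from the origin. -/
def SmoothOffOrigin (h : ℝ × ℝ → ℝ) : Prop :=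
  ∀ q ∈ quadrant, q ≠ 0 → ContDiffWithinAt ℝ ∞ h quadrant q

lemma IsHomogeneousProfile.smoothOffOrigin (hf : IsHomogeneousProfile h) : SmoothOffOrigin h := by
  intro q hq hq0
  refine (hf.smooth q ⟨hq, hq0⟩).mono_of_mem_nhdsWithin ?_
  exact Filter.inter_mem self_mem_nhdsWithin (mem_nhdsWithin_of_mem_nhds (isOpen_ne.mem_nhds hq0))

lemma SmoothOffOrigin.fderivWithin_apply (hh : SmoothOffOrigin h) (w : ℝ × ℝ) :
    SmoothOffOrigin (fun q => fderivWithin ℝ h quadrant q w) := by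
  intro q hq hq0
  exact ((hh q hq hq0).fderivWithin_right uniqueDiffOn_quadrant (m := ∞) (by simp) hq).clm_apply
    contDiffWithinAt_const

lemma SmoothOffOrigin.partialS (hh : SmoothOffOrigin h) : SmoothOffOrigin (partialS h) :=
  hh.fderivWithin_apply _

lemma SmoothOffOrigin.partialT (hh : SmoothOffOrigin h) : SmoothOffOrigin (partialT h) :=
  hh.fderivWithin_apply _

lemma SmoothOffOrigin.differentiableWithinAt (hh : SmoothOffOrigin h) (hq : q ∈ quadrant)
    (hq0 : q ≠ 0) : DifferentiableWithinAt ℝ h quadrant q :=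
  (hh q hq hq0).differentiableWithinAt (by simp)

lemma SmoothOffOrigin.contDiffAt_comp {X : Type*} [NormedAddCommGroup X] [NormedSpace ℝ X]
    (hh : SmoothOffOrigin h) {S T : X → ℝ} {x : X} (hS : ContDiffAt ℝ ∞ S x)
    (hT : ContDiffAt ℝ ∞ T x) (hm : ∀ᶠ z in nhds x, (S z, T z) ∈ quadrant)
    (h0 : (S x, T x) ≠ 0) : ContDiffAt ℝ ∞ (fun z => h (S z, T z)) x := by
  have h1 := hh _ hm.self_of_nhds h0
  have h2 : ContDiffAt ℝ ∞ (fun z => (S z, T z)) x := hS.prodMk hT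
  have h3 : ContDiffWithinAt ℝ ∞ (h ∘ fun z => (S z, T z)) {z | (S z, T z) ∈ quadrant} x :=
    ContDiffWithinAt.comp x h1 h2.contDiffWithinAt (fun z hz => hz)
  exact h3.contDiffAt hm

/-- On the edges the derivatives of `h` are one-sided, but a map that stays in the quadrant near `x`
sees nothing else, so the composite has an honest derivative. This is what makes `F^2`
differentiable at vectors with one zero component. -/
lemma SmoothOffOrigin.hasFDerivAt_comp {X : Type*} [NormedAddCommGroup X] [NormedSpace ℝ X]
    (hh : SmoothOffOrigin h) {S T : X → ℝ} {S' T' : X →L[ℝ] ℝ} {x : X} (hS : HasFDerivAt S S' x)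
    (hT : HasFDerivAt T T' x) (hm : ∀ᶠ z in nhds x, (S z, T z) ∈ quadrant)
    (h0 : (S x, T x) ≠ 0) :
    HasFDerivAt (fun z => h (S z, T z))
      (Finsler.partialS h (S x, T x) • S' + Finsler.partialT h (S x, T x) • T') x := by
  have h1 := (hh.differentiableWithinAt hm.self_of_nhds h0).hasFDerivWithinAt
  have h2 := h1.comp_hasFDerivAt (f := fun z => (S z, T z)) x (hS.prodMk hT) hm
  refine h2.congr_fderiv ?_
  ext u
  have : (S' u, T' u) = S' u • ((1 : ℝ), (0 : ℝ)) + T' u • ((0 : ℝ), (1 : ℝ)) := by simp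
  simp only [ContinuousLinearMap.comp_apply, ContinuousLinearMap.prod_apply, this, map_add,
    map_smul, smul_eq_mul, add_apply, smul_apply,
    Finsler.partialS, Finsler.partialT]
  ring

lemma SmoothOffOrigin.hasDerivAt_comp (hh : SmoothOffOrigin h) {S T : ℝ → ℝ} {S' T' x : ℝ}
    (hS : HasDerivAt S S' x) (hT : HasDerivAt T T' x)
    (hm : ∀ᶠ z in nhds x, (S z, T z) ∈ quadrant) (h0 : (S x, T x) ≠ 0) :
    HasDerivAt (fun z => h (S z, T z))
      (Finsler.partialS h (S x, T x) * S' + Finsler.partialT h (S x, T x) * T') x := by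
  simpa using (hh.hasFDerivAt_comp hS.hasFDerivAt hT.hasFDerivAt hm h0).hasDerivAt

lemma SmoothOffOrigin.partialS_partialT (hh : SmoothOffOrigin h) (hq : q ∈ quadrant)
    (hq0 : q ≠ 0) : Finsler.partialS (Finsler.partialT h) q =
      Finsler.partialT (Finsler.partialS h) q := by
  have hs := (hh q hq hq0).isSymmSndFDerivWithinAt
    (by simpa using WithTop.coe_le_coe.2 (le_top : (2 : ℕ∞) ≤ ⊤))
    uniqueDiffOn_quadrant (mem_closure_interior_quadrant hq) hq
  have hd : DifferentiableWithinAt ℝ (fderivWithin ℝ h quadrant) quadrant q :=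
    ((hh q hq hq0).fderivWithin_right uniqueDiffOn_quadrant (m := ∞) (by simp)
      hq).differentiableWithinAt (by simp)
  have key : ∀ v w : ℝ × ℝ, fderivWithin ℝ (fun q => fderivWithin ℝ h quadrant q v) quadrant q w =
      fderivWithin ℝ (fderivWithin ℝ h quadrant) quadrant q w v := by
    intro v w
    have := (hd.hasFDerivWithinAt.clm_apply (hasFDerivWithinAt_const v q quadrant)).fderivWithin
      (uniqueDiffOn_quadrant q hq)
    rw [this]; simp
  change fderivWithin ℝ (fun q => fderivWithin ℝ h quadrant q (0, 1)) quadrant q (1, 0) =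
    fderivWithin ℝ (fun q => fderivWithin ℝ h quadrant q (1, 0)) quadrant q (0, 1)
  rw [key, key]
  exact hs _ _

/-! Euler's relations. -/

variable {f : ℝ × ℝ → ℝ}

lemma smul_mem_quadrant (hq : q ∈ quadrant) {r : ℝ} (hr : 0 < r) : r • q ∈ quadrant :=
  ⟨mul_nonneg hr.le hq.1, mul_nonneg hr.le hq.2⟩

lemma IsHomogeneousProfile.map_zero (hf : IsHomogeneousProfile f) : f 0 = 0 := by
  have := hf.homogeneous 0 ⟨le_rfl, le_rfl⟩ 2 two_pos
  rw [smul_zero] at this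
  linarith

lemma IsHomogeneousProfile.pos (hf : IsHomogeneousProfile f) (hq : q ∈ quadrant) (hq0 : q ≠ 0) :
    0 < f q :=
  lt_of_le_of_ne (hf.nonneg q hq) (hf.ne_zero q hq hq0).symm

lemma SmoothOffOrigin.hasDerivAt_ray (hh : SmoothOffOrigin h) (hq : q ∈ quadrant) (hq0 : q ≠ 0) :
    HasDerivAt (fun r : ℝ => h (r • q))
      (q.1 * Finsler.partialS h q + q.2 * Finsler.partialT h q) 1 := by
  have h1 : HasDerivAt (fun r : ℝ => r * q.1) q.1 1 := by
    simpa using (hasDerivAt_id (1 : ℝ)).mul_const q.1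
  have h2 : HasDerivAt (fun r : ℝ => r * q.2) q.2 1 := by
    simpa using (hasDerivAt_id (1 : ℝ)).mul_const q.2
  have h3 := hh.hasDerivAt_comp h1 h2
    ((eventually_gt_nhds one_pos).mono fun r hr => smul_mem_quadrant hq hr) (by simpa using hq0)
  simp only [one_mul] at h3
  rw [mul_comm q.1, mul_comm q.2]
  exact h3

lemma IsHomogeneousProfile.euler (hf : IsHomogeneousProfile f) (hq : q ∈ quadrant) (hq0 : q ≠ 0) :
    q.1 * partialS f q + q.2 * partialT f q = f q := by
  have h1 := hf.smoothOffOrigin.hasDerivAt_ray hq hq0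
  have h2 : HasDerivAt (fun r : ℝ => r * f q) (f q) 1 := by
    simpa using (hasDerivAt_id (1 : ℝ)).mul_const (f q)
  exact h1.unique (h2.congr_of_eventuallyEq
    ((eventually_gt_nhds one_pos).mono fun r hr => hf.homogeneous q hq r hr))

/-- Differentiating Euler's relation along the quadrant. -/
lemma IsHomogeneousProfile.fderivWithin_euler (hf : IsHomogeneousProfile f) (hq : q ∈ quadrant)
    (hq0 : q ≠ 0) (w : ℝ × ℝ) :
    q.1 * fderivWithin ℝ (partialS f) quadrant q w +
      q.2 * fderivWithin ℝ (partialT f) quadrant q w +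
      (w.1 * partialS f q + w.2 * partialT f q) = fderivWithin ℝ f quadrant q w := by
  have hS := (hf.smoothOffOrigin.partialS.differentiableWithinAt hq hq0).hasFDerivWithinAt
  have hT := (hf.smoothOffOrigin.partialT.differentiableWithinAt hq hq0).hasFDerivWithinAt
  have h1 := ((hasFDerivWithinAt_fst (s := quadrant) (p := q)).mul hS).add
    ((hasFDerivWithinAt_snd (s := quadrant) (p := q)).mul hT)
  have hU := uniqueDiffOn_quadrant q hq
  have h2 := h1.fderivWithin hU
  rw [← Filter.EventuallyEq.fderivWithin_eq (f₁ := f) (s := quadrant)] at h2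
  · rw [h2]
    simp only [add_apply, smul_apply, smul_eq_mul,
      ContinuousLinearMap.coe_fst',
      ContinuousLinearMap.coe_snd']
    ring
  · filter_upwards [self_mem_nhdsWithin, mem_nhdsWithin_of_mem_nhds (isOpen_ne.mem_nhds hq0)]
      with z hz hz0
    exact (hf.euler hz hz0).symm
  · exact (hf.euler hq hq0).symm

/-- The derivative of Euler's relation in the direction `s` contains `f_s` on both sides, and it
cancels. Together with `euler_T` this makes `f_st` vanish on both axes, `f_tt` on `s = 0` and `f_ss`
on `t = 0`. -/
lemma IsHomogeneousProfile.euler_S (hf : IsHomogeneousProfile f) (hq : q ∈ quadrant)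
    (hq0 : q ≠ 0) : q.1 * partialS (partialS f) q + q.2 * partialT (partialS f) q = 0 := by
  have h1 := hf.fderivWithin_euler hq hq0 (1, 0)
  rw [← hf.smoothOffOrigin.partialS_partialT hq hq0]
  simp only [one_mul, zero_mul, add_zero] at h1
  change q.1 * partialS (partialS f) q + q.2 * partialS (partialT f) q + partialS f q =
    partialS f q at h1
  linarith

lemma IsHomogeneousProfile.euler_T (hf : IsHomogeneousProfile f) (hq : q ∈ quadrant)
    (hq0 : q ≠ 0) : q.1 * partialT (partialS f) q + q.2 * partialT (partialT f) q = 0 := by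
  have h1 := hf.fderivWithin_euler hq hq0 (0, 1)
  simp only [one_mul, zero_mul, zero_add] at h1
  change q.1 * partialT (partialS f) q + q.2 * partialT (partialT f) q + partialT f q =
    partialT f q at h1
  linarith

end Profile

/-! ### Raising indices -/

section Raise

variable {E : Type*} [NormedAddCommGroup E] [NormedSpace ℝ E]

/-- Positivity gives injectivity, and the dimensions agree. Invertibility is essential because
`raise` takes the value zero on noninvertible forms. -/
lemma isInvertible_of_posDef [FiniteDimensional ℝ E] {B : E →L[ℝ] E →L[ℝ] ℝ}
    (hB : ∀ u, u ≠ 0 → 0 < B u u) : B.IsInvertible := by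
  have hinj : Function.Injective B.toLinearMap := by
    rw [← LinearMap.ker_eq_bot, LinearMap.ker_eq_bot']
    intro u hu
    by_contra h
    have h1 := hB u h
    have h2 : B u = 0 := hu
    simp [h2] at h1
  have hdim : Module.finrank ℝ E = Module.finrank ℝ (E →L[ℝ] ℝ) := by
    rw [← (LinearMap.toContinuousLinearMap : (E →ₗ[ℝ] ℝ) ≃ₗ[ℝ] (E →L[ℝ] ℝ)).finrank_eq]
    exact (Subspace.dual_finrank_eq (K := ℝ) (V := E)).symm
  exact ⟨(LinearMap.linearEquivOfInjective B.toLinearMap hinj hdim).toContinuousLinearEquiv,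
    by ext; rfl⟩

lemma raise_eq {B : E →L[ℝ] E →L[ℝ] ℝ} (hB : B.IsInvertible) {ξ : E →L[ℝ] ℝ} {u : E}
    (h : ∀ w, B u w = ξ w) : raise B ξ = u := by
  have : ξ = B u := by ext w; exact (h w).symm
  rw [raise, this]
  exact hB.inverse_apply_self u

lemma apply_raise {B : E →L[ℝ] E →L[ℝ] ℝ} (hB : B.IsInvertible) (ξ : E →L[ℝ] ℝ) (w : E) :
    B (raise B ξ) w = ξ w := by
  rw [raise, hB.self_apply_inverse]

end Raise

/-! ### Riemannian metrics in coordinates -/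

section Metric

variable {E : Type*} [NormedAddCommGroup E] [NormedSpace ℝ E]

/-- A smooth Riemannian metric on an open set of the model space. -/
structure IsMetricOn (γ : E → E →L[ℝ] E →L[ℝ] ℝ) (U : Set E) : Prop where
  isOpen : IsOpen U
  smooth : ContDiffOn ℝ ∞ γ U
  symm : ∀ p ∈ U, ∀ v w, γ p v w = γ p w v
  pos : ∀ p ∈ U, ∀ v, v ≠ 0 → 0 < γ p v v

/-- `koszul H` as a continuous bilinear map. -/
def koszulCLM (H : E →L[ℝ] E →L[ℝ] E →L[ℝ] ℝ) : E →L[ℝ] E →L[ℝ] E →L[ℝ] ℝ :=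
  (1 / 2 : ℝ) • (H + H.flip -
    (ContinuousLinearMap.flipₗᵢ ℝ E E ℝ).toContinuousLinearEquiv.toContinuousLinearMap.comp H.flip)

lemma koszulCLM_apply (H : E →L[ℝ] E →L[ℝ] E →L[ℝ] ℝ) (a b : E) :
    koszulCLM H a b = koszul H a b := by
  ext c
  simp [koszulCLM, koszul]

lemma koszul_apply (H : E →L[ℝ] E →L[ℝ] E →L[ℝ] ℝ) (a b c : E) :
    koszul H a b c = (1 / 2) * (H a b c + H b a c - H c a b) := by
  simp [koszul]

/-- The Christoffel symbols as a continuous bilinear map. -/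
def christoffelCLM (γ : E → E →L[ℝ] E →L[ℝ] ℝ) (p : E) : E →L[ℝ] E →L[ℝ] E :=
  (ContinuousLinearMap.compL ℝ E (E →L[ℝ] ℝ) E (γ p).inverse).comp (koszulCLM (fderiv ℝ γ p))

lemma christoffelCLM_apply (γ : E → E →L[ℝ] E →L[ℝ] ℝ) (p a b : E) :
    christoffelCLM γ p a b = christoffelCoord γ p a b := by
  simp [christoffelCLM, christoffelCoord, raise, koszulCLM_apply]

namespace IsMetricOn

variable {γ : E → E →L[ℝ] E →L[ℝ] ℝ} {U : Set E} {p : E}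

lemma contDiffAt (hγ : IsMetricOn γ U) (hp : p ∈ U) : ContDiffAt ℝ ∞ γ p :=
  hγ.smooth.contDiffAt (hγ.isOpen.mem_nhds hp)

lemma differentiableAt (hγ : IsMetricOn γ U) (hp : p ∈ U) : DifferentiableAt ℝ γ p :=
  (hγ.contDiffAt hp).differentiableAt (by simp)

lemma nonneg (hγ : IsMetricOn γ U) (hp : p ∈ U) (v : E) : 0 ≤ γ p v v := by
  by_cases h : v = 0
  · simp [h]
  · exact (hγ.pos p hp v h).le

lemma eq_zero (hγ : IsMetricOn γ U) (hp : p ∈ U) {v : E} (h : γ p v v = 0) : v = 0 := by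
  by_contra h0
  exact (hγ.pos p hp v h0).ne' h

lemma isInvertible [FiniteDimensional ℝ E] (hγ : IsMetricOn γ U) (hp : p ∈ U) :
    (γ p).IsInvertible := isInvertible_of_posDef (hγ.pos p hp)

lemma fderiv_apply (hγ : IsMetricOn γ U) (hp : p ∈ U) (a b c : E) :
    fderiv ℝ (fun q => γ q b c) p a = fderiv ℝ γ p a b c := by
  have h := ((hγ.differentiableAt hp).hasFDerivAt.clm_apply (hasFDerivAt_const b p)).clm_apply
    (hasFDerivAt_const c p)
  rw [h.fderiv]; simp

lemma fderiv_symm (hγ : IsMetricOn γ U) (hp : p ∈ U) (a b c : E) :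
    fderiv ℝ γ p a b c = fderiv ℝ γ p a c b := by
  rw [← hγ.fderiv_apply hp, ← hγ.fderiv_apply hp]
  congr 1
  apply Filter.EventuallyEq.fderiv_eq
  filter_upwards [hγ.isOpen.mem_nhds hp] with q hq
  exact hγ.symm q hq b c

variable [FiniteDimensional ℝ E]

lemma apply_christoffel (hγ : IsMetricOn γ U) (hp : p ∈ U) (a b c : E) :
    γ p (christoffelCLM γ p a b) c =
      (1 / 2) * (fderiv ℝ γ p a b c + fderiv ℝ γ p b a c - fderiv ℝ γ p c a b) := by
  rw [christoffelCLM_apply, christoffelCoord, apply_raise (hγ.isInvertible hp), koszul_apply]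

lemma christoffel_symm (hγ : IsMetricOn γ U) (hp : p ∈ U) (a b : E) :
    christoffelCLM γ p a b = christoffelCLM γ p b a := by
  rw [christoffelCLM_apply, christoffelCLM_apply, christoffelCoord]
  refine raise_eq (hγ.isInvertible hp) fun w => ?_
  rw [← christoffelCLM_apply, hγ.apply_christoffel hp, koszul_apply, hγ.fderiv_symm hp w a b]
  ring

/-- The Levi-Civita connection is metric. -/
lemma fderiv_eq (hγ : IsMetricOn γ U) (hp : p ∈ U) (a b c : E) :
    fderiv ℝ γ p a b c =
      γ p (christoffelCLM γ p a b) c + γ p (christoffelCLM γ p a c) b := by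
  rw [hγ.apply_christoffel hp, hγ.apply_christoffel hp, hγ.fderiv_symm hp a c b,
    hγ.fderiv_symm hp b a c, hγ.fderiv_symm hp c a b]
  ring

lemma contDiffAt_christoffel (hγ : IsMetricOn γ U) (hp : p ∈ U) :
    ContDiffAt ℝ ∞ (christoffelCLM γ) p := by
  obtain ⟨e, he⟩ := hγ.isInvertible hp
  have h1 : ContDiffAt ℝ ∞ (fun q => (γ q).inverse) p := by
    have := contDiffAt_map_inverse (n := ∞) e
    rw [he] at this
    exact ContDiffAt.comp p this (hγ.contDiffAt hp)
  have h2 : ContDiffAt ℝ ∞ (fderiv ℝ γ) p := (hγ.contDiffAt hp).fderiv_right (by simp)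
  have h3 : ContDiffAt ℝ ∞ (fun q => koszulCLM (fderiv ℝ γ q)) p := by
    unfold koszulCLM
    have h4 : ContDiffAt ℝ ∞ (fun q => (fderiv ℝ γ q).flip) p :=
      (ContinuousLinearMap.flipₗᵢ ℝ E E (E →L[ℝ] ℝ)).contDiff.contDiffAt.comp p h2
    exact ((h2.add h4).sub (contDiffAt_const.clm_comp h4)).const_smul _
  unfold christoffelCLM
  exact ((ContinuousLinearMap.compL ℝ E (E →L[ℝ] ℝ) E).contDiff.contDiffAt.comp p h1).clm_comp h3

lemma differentiableAt_christoffel (hγ : IsMetricOn γ U) (hp : p ∈ U) :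
    DifferentiableAt ℝ (christoffelCLM γ) p :=
  (hγ.contDiffAt_christoffel hp).differentiableAt (by simp)

end IsMetricOn

/-- The derivative of a family of bilinear maps, evaluated on constant vectors. -/
lemma fderiv_bilin_apply {F : Type*} [NormedAddCommGroup F] [NormedSpace ℝ F]
    {C : E → E →L[ℝ] E →L[ℝ] F} {p : E} (hC : DifferentiableAt ℝ C p)
    (a b c : E) : fderiv ℝ (fun q => C q b c) p a = fderiv ℝ C p a b c := by
  have h := (hC.hasFDerivAt.clm_apply (hasFDerivAt_const b p)).clm_apply (hasFDerivAt_const c p)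
  rw [h.fderiv]; simp

lemma differentiableAt_bilin_apply {F : Type*} [NormedAddCommGroup F] [NormedSpace ℝ F]
    {C : E → E →L[ℝ] E →L[ℝ] F} {p : E} (hC : DifferentiableAt ℝ C p)
    (b c : E) : DifferentiableAt ℝ (fun q => C q b c) p :=
  ((hC.hasFDerivAt.clm_apply (hasFDerivAt_const b p)).clm_apply
    (hasFDerivAt_const c p)).differentiableAt

/-- The curvature form of a symmetric connection given by `C`, on the pair `(u, v)` applied to
`v`. -/
def connectionCurvature (C : E → E →L[ℝ] E →L[ℝ] E) (p u v : E) : E :=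
  fderiv ℝ C p u v v - fderiv ℝ C p v u v + C p u (C p v v) - C p v (C p u v)

lemma hasFDerivAt_half_quadratic {F : Type*} [NormedAddCommGroup F] [NormedSpace ℝ F]
    {C : E →L[ℝ] E →L[ℝ] F} (hC : ∀ a b, C a b = C b a) (w : E) :
    HasFDerivAt (fun w => (1 / 2 : ℝ) • C w w) (C w) w := by
  have h := (C.hasFDerivAt (x := w)).clm_apply (hasFDerivAt_id w)
  refine (h.const_smul (1 / 2 : ℝ)).congr_fderiv ?_
  ext u
  simp only [smul_apply, add_apply, ContinuousLinearMap.comp_apply,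
    ContinuousLinearMap.id_apply, ContinuousLinearMap.flip_apply, id, hC u w]
  rw [← two_smul ℝ, smul_smul]
  norm_num

/-- The Riemann tensor of a spray which is quadratic in the velocity is the curvature of the
associated affine connection. -/
lemma riemannCoord_of_quadratic {L : E → E → ℝ} {C : E → E →L[ℝ] E →L[ℝ] E} {U V : Set E}
    (hU : IsOpen U) (hV : IsOpen V) {p v : E} (hp : p ∈ U) (hv : v ∈ V)
    (hC : DifferentiableAt ℝ C p) (hsymm : ∀ q ∈ U, ∀ a b, C q a b = C q b a)
    (hG : ∀ q ∈ U, ∀ w ∈ V, sprayCoord L q w = (1 / 2 : ℝ) • C q w w) (u : E) :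
    riemannCoord L p v u = connectionCurvature C p u v := by
  have hd : ∀ q ∈ U, ∀ w ∈ V, HasFDerivAt (sprayCoord L q) (C q w) w := by
    intro q hq w hw
    refine (hasFDerivAt_half_quadratic (hsymm q hq) w).congr_of_eventuallyEq ?_
    filter_upwards [hV.mem_nhds hw] with z hz
    exact hG q hq z hz
  have h1 : fderiv ℝ (fun q => sprayCoord L q v) p u = (1 / 2 : ℝ) • fderiv ℝ C p u v v := by
    have : (fun q => sprayCoord L q v) =ᶠ[nhds p] fun q => (1 / 2 : ℝ) • C q v v := by
      filter_upwards [hU.mem_nhds hp] with q hq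
      exact hG q hq v hv
    rw [this.fderiv_eq, fderiv_fun_const_smul (differentiableAt_bilin_apply hC v v),
      smul_apply, fderiv_bilin_apply hC]
  have h2 : fderiv ℝ (fun q => fderiv ℝ (sprayCoord L q) v) p v u = fderiv ℝ C p v u v := by
    have : (fun q => fderiv ℝ (sprayCoord L q) v) =ᶠ[nhds p] fun q => C q v := by
      filter_upwards [hU.mem_nhds hp] with q hq
      exact (hd q hq v hv).fderiv
    rw [this.fderiv_eq, (hC.hasFDerivAt.clm_apply (hasFDerivAt_const v p)).fderiv]
    simp only [ContinuousLinearMap.comp_zero, zero_add, ContinuousLinearMap.flip_apply]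
    rw [← fderiv_bilin_apply hC, ← fderiv_bilin_apply hC]
    congr 1
    apply Filter.EventuallyEq.fderiv_eq
    filter_upwards [hU.mem_nhds hp] with q hq
    exact hsymm q hq v u
  have h3 : fderiv ℝ (fderiv ℝ (sprayCoord L p)) v = C p := by
    have : fderiv ℝ (sprayCoord L p) =ᶠ[nhds v] C p := by
      filter_upwards [hV.mem_nhds hv] with w hw
      exact (hd p hp w hw).fderiv
    rw [this.fderiv_eq]
    exact (C p).fderiv
  have h4 : fderiv ℝ (sprayCoord L p) v = C p v := (hd p hp v hv).fderiv
  -- The factors `2` in the Riemann tensor absorb the halves in the spray; what remains is matched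
  -- by the symmetry of `C`.
  simp only [riemannCoord, connectionCurvature, smul_apply, add_apply, sub_apply,
    ContinuousLinearMap.comp_apply, h1, h2, h3, h4, hG p hp v hv, map_smul, smul_smul]
  rw [hsymm p hp u v, hsymm p hp u (C p v v)]
  norm_num

end Metric

/-! ### Spray and curvature of a Riemannian metric -/

section Riemann

variable {E : Type*} [NormedAddCommGroup E] [NormedSpace ℝ E]
variable {γ : E → E →L[ℝ] E →L[ℝ] ℝ} {U : Set E} {p : E}

namespace IsMetricOn

lemma fderiv_norm_sq (hγ : IsMetricOn γ U) (hp : p ∈ U) (w : E) :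
    HasFDerivAt (fun w => γ p w w) ((2 : ℝ) • γ p w) w := by
  have h := (hasFDerivAt_half_quadratic (hγ.symm p hp) w).const_smul (2 : ℝ)
  refine h.congr_of_eventuallyEq (Filter.Eventually.of_forall fun z => ?_)
  simp

variable {L : E → E → ℝ} [FiniteDimensional ℝ E]

lemma sprayCoord_eq (hγ : IsMetricOn γ U) (hL : ∀ q ∈ U, ∀ w, L q w ^ 2 = γ q w w) (hp : p ∈ U)
    (v : E) : sprayCoord L p v = (1 / 2 : ℝ) • christoffelCLM γ p v v := by
  have h0 : ∀ q ∈ U, (fun w => L q w ^ 2) = fun w => γ q w w := fun q hq => funext (hL q hq)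
  have h1 : ∀ q ∈ U, fderiv ℝ (fun w => L q w ^ 2) = fun w => ((2 : ℝ) • γ q) w := by
    intro q hq
    ext w : 1
    rw [h0 q hq]
    exact (hγ.fderiv_norm_sq hq w).fderiv
  have h2 : fundCoord L p v = γ p := by
    rw [fundCoord, h1 p hp]
    change (1 / 2 : ℝ) • fderiv ℝ (⇑((2 : ℝ) • γ p)) v = _
    rw [((2 : ℝ) • γ p).fderiv, smul_smul]
    norm_num
  have h3 : fderiv ℝ (fun q => fderiv ℝ (fun w => L q w ^ 2) v) p v =
      (2 : ℝ) • fderiv ℝ γ p v v := by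
    have : (fun q => fderiv ℝ (fun w => L q w ^ 2) v) =ᶠ[nhds p] fun q => (2 : ℝ) • γ q v := by
      filter_upwards [hγ.isOpen.mem_nhds hp] with q hq
      rw [h1 q hq]; rfl
    have h := ((hγ.differentiableAt hp).hasFDerivAt.clm_apply
      (hasFDerivAt_const v p)).fun_const_smul (2 : ℝ)
    rw [this.fderiv_eq, h.fderiv]
    simp
  have h4 : ∀ c, fderiv ℝ (fun q => L q v ^ 2) p c = fderiv ℝ γ p c v v := by
    intro c
    rw [← hγ.fderiv_apply hp]
    congr 1
    apply Filter.EventuallyEq.fderiv_eq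
    filter_upwards [hγ.isOpen.mem_nhds hp] with q hq
    exact hL q hq v
  rw [sprayCoord, h2]
  refine raise_eq (hγ.isInvertible hp) fun c => ?_
  rw [map_smul, smul_apply, hγ.apply_christoffel hp, h3]
  simp only [smul_apply, sub_apply, h4, smul_eq_mul]
  ring

lemma riemannCoord_eq (hγ : IsMetricOn γ U) (hL : ∀ q ∈ U, ∀ w, L q w ^ 2 = γ q w w)
    (hp : p ∈ U) (v u : E) :
    riemannCoord L p v u = connectionCurvature (christoffelCLM γ) p u v :=
  riemannCoord_of_quadratic hγ.isOpen isOpen_univ hp (Set.mem_univ v)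
    (hγ.differentiableAt_christoffel hp) (fun _ hq => hγ.christoffel_symm hq)
    (fun _ hq w _ => hγ.sprayCoord_eq hL hq w) u

lemma curvatureCoord_eq (hγ : IsMetricOn γ U) (hp : p ∈ U) (u v : E) :
    curvatureCoord γ p u v v = connectionCurvature (christoffelCLM γ) p u v := by
  have hd := hγ.differentiableAt_christoffel hp
  simp only [curvatureCoord, connectionCurvature, ← christoffelCLM_apply, fderiv_bilin_apply hd]

/-- The curvature operator `R(u, v)` is skew-symmetric, so `R(u, v)v` is orthogonal to `v`. -/
lemma apply_connectionCurvature (hγ : IsMetricOn γ U) (hp : p ∈ U) (u v : E) :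
    γ p (connectionCurvature (christoffelCLM γ) p u v) v = 0 := by
  set C := christoffelCLM γ with hCdef
  have hC : DifferentiableAt ℝ C p := hγ.differentiableAt_christoffel hp
  -- Metric compatibility computes the second derivative of `q ↦ γ_q(v, v)`. Its antisymmetric part
  -- in `a`, `b` is twice `γ(R(a, b)v, v)`, so the claim is the symmetry of second derivatives.
  have key : ∀ a b : E, fderiv ℝ (fderiv ℝ (fun q => γ q v v)) p a b =
      2 * (γ p (C p a (C p b v)) v + γ p (C p a v) (C p b v) + γ p (fderiv ℝ C p a b v) v) := by
    intro a b
    have e0 : ContDiffAt ℝ ∞ (fun q => γ q v v) p :=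
      ((hγ.contDiffAt hp).clm_apply contDiffAt_const).clm_apply contDiffAt_const
    have e1 : DifferentiableAt ℝ (fderiv ℝ (fun q => γ q v v)) p :=
      (e0.fderiv_right (m := ∞) (by simp)).differentiableAt (by simp)
    have e2 : fderiv ℝ (fderiv ℝ (fun q => γ q v v)) p a b =
        fderiv ℝ (fun q => fderiv ℝ (fun q => γ q v v) q b) p a := by
      rw [(e1.hasFDerivAt.clm_apply (hasFDerivAt_const b p)).fderiv]; simp
    have e3 : (fun q => fderiv ℝ (fun q => γ q v v) q b) =ᶠ[nhds p]
        fun q => 2 * γ q (C q b v) v := by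
      filter_upwards [hγ.isOpen.mem_nhds hp] with q hq
      rw [hγ.fderiv_apply hq, hγ.fderiv_eq hq]
      ring
    have e4 := (((hγ.differentiableAt hp).hasFDerivAt.clm_apply
      (differentiableAt_bilin_apply hC b v).hasFDerivAt).clm_apply
      (hasFDerivAt_const v p)).const_mul 2
    rw [e2, e3.fderiv_eq, e4.fderiv]
    simp only [ContinuousLinearMap.comp_zero, zero_add, smul_apply,
      ContinuousLinearMap.flip_apply, add_apply, ContinuousLinearMap.comp_apply,
      fderiv_bilin_apply hC, smul_eq_mul, hγ.fderiv_eq hp]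
    ring
  have hs : IsSymmSndFDerivAt ℝ (fun q => γ q v v) p := by
    have e0 : ContDiffAt ℝ ∞ (fun q => γ q v v) p :=
      ((hγ.contDiffAt hp).clm_apply contDiffAt_const).clm_apply contDiffAt_const
    exact e0.isSymmSndFDerivAt (by simpa using WithTop.coe_le_coe.2 (le_top : (2 : ℕ∞) ≤ ⊤))
  have h1 := key u v
  have h2 := key v u
  rw [hs u v, h2] at h1
  simp only [connectionCurvature, map_add, map_sub, add_apply, sub_apply]
  rw [hγ.symm p hp (C p v v) (C p u v)] at h1
  linarith

end IsMetricOn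

lemma connectionCurvature_self {C : E → E →L[ℝ] E →L[ℝ] E} (v : E) (c : ℝ) :
    connectionCurvature C p (c • v) v = 0 := by
  simp [connectionCurvature]

end Riemann

/-! ### Covariant differentiation along curves -/

section Curves

variable {E : Type*} [NormedAddCommGroup E] [NormedSpace ℝ E]

/-- The product rule for the covariant derivative along a curve. -/
lemma IsMetricOn.hasDerivAt_apply [FiniteDimensional ℝ E] {γ : E → E →L[ℝ] E →L[ℝ] ℝ} {U : Set E}
    (hγ : IsMetricOn γ U) {c X Y : ℝ → E} {c' X' Y' : E} {t : ℝ} (hp : c t ∈ U)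
    (hc : HasDerivAt c c' t) (hX : HasDerivAt X X' t) (hY : HasDerivAt Y Y' t) :
    HasDerivAt (fun r => γ (c r) (X r) (Y r))
      (γ (c t) (X' + christoffelCLM γ (c t) c' (X t)) (Y t) +
        γ (c t) (X t) (Y' + christoffelCLM γ (c t) c' (Y t))) t := by
  have h1 := (hγ.differentiableAt hp).hasFDerivAt.comp_hasDerivAt t hc
  have h2 := (h1.clm_apply hX).clm_apply hY
  refine h2.congr_deriv ?_
  simp only [Function.comp, add_apply, map_add, hγ.fderiv_eq hp]
  rw [hγ.symm _ hp (X t) (christoffelCLM γ (c t) c' (Y t))]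
  ring

/-- Once differentiability of an operator-valued map is known abstractly, its derivative can be read
off from one curve and one fixed argument at a time. This reduces the multilinear computations below
to derivatives of real functions. -/
lemma fderiv_apply_eq_of_hasDerivAt {X F : Type*} [NormedAddCommGroup X] [NormedSpace ℝ X]
    [NormedAddCommGroup F] [NormedSpace ℝ F] {Φ : X → E →L[ℝ] F} {c : ℝ → X} {c' : X} {t : ℝ}
    (hΦ : DifferentiableAt ℝ Φ (c t)) (hc : HasDerivAt c c' t) {b : E} {d : F}
    (h : HasDerivAt (fun r => Φ (c r) b) d t) : fderiv ℝ Φ (c t) c' b = d := by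
  have h1 := hΦ.hasFDerivAt.comp_hasDerivAt t hc
  have h2 := h1.clm_apply (hasDerivAt_const t b)
  simp only [map_zero, add_zero] at h2
  exact h2.unique h

lemma hasDerivAt_line (p a : E) : HasDerivAt (fun r : ℝ => p + r • a) a 0 := by
  simpa using ((hasDerivAt_id (0 : ℝ)).smul_const a).const_add p

end Curves

/-! ### Derivatives of the squared product metric in coordinates -/

section ProductCoordinates

variable {E₁ : Type*} [NormedAddCommGroup E₁] [NormedSpace ℝ E₁]
  {E₂ : Type*} [NormedAddCommGroup E₂] [NormedSpace ℝ E₂]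

/-- The pair of squared norms of the two components of a tangent vector. -/
def normPair (γ₁ : E₁ → E₁ →L[ℝ] E₁ →L[ℝ] ℝ) (γ₂ : E₂ → E₂ →L[ℝ] E₂ →L[ℝ] ℝ) (p v : E₁ × E₂) :
    ℝ × ℝ :=
  (γ₁ p.1 v.1 v.1, γ₂ p.2 v.2 v.2)

/-- `L` is the coordinate expression of `√(f(α₁², α₂²))` on `U₁ × U₂`. -/
structure IsProductOn (f : ℝ × ℝ → ℝ) (γ₁ : E₁ → E₁ →L[ℝ] E₁ →L[ℝ] ℝ) (U₁ : Set E₁)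
    (γ₂ : E₂ → E₂ →L[ℝ] E₂ →L[ℝ] ℝ) (U₂ : Set E₂) (L : E₁ × E₂ → E₁ × E₂ → ℝ) : Prop where
  profile : IsHomogeneousProfile f
  metric₁ : IsMetricOn γ₁ U₁
  metric₂ : IsMetricOn γ₂ U₂
  eq_sqrt : ∀ q ∈ U₁ ×ˢ U₂, ∀ w, L q w = Real.sqrt (f (normPair γ₁ γ₂ q w))

/-- The differential of `F² / 2` along the fibres. -/
def productLegendre (f : ℝ × ℝ → ℝ) (γ₁ : E₁ → E₁ →L[ℝ] E₁ →L[ℝ] ℝ)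
    (γ₂ : E₂ → E₂ →L[ℝ] E₂ →L[ℝ] ℝ) (p v b : E₁ × E₂) : ℝ :=
  partialS f (normPair γ₁ γ₂ p v) * γ₁ p.1 v.1 b.1 +
    partialT f (normPair γ₁ γ₂ p v) * γ₂ p.2 v.2 b.2

/-- The fundamental tensor of `√(f(α₁², α₂²))`. -/
def productForm (f : ℝ × ℝ → ℝ) (γ₁ : E₁ → E₁ →L[ℝ] E₁ →L[ℝ] ℝ)
    (γ₂ : E₂ → E₂ →L[ℝ] E₂ →L[ℝ] ℝ) (p v a b : E₁ × E₂) : ℝ :=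
  partialS f (normPair γ₁ γ₂ p v) * γ₁ p.1 a.1 b.1 +
  partialT f (normPair γ₁ γ₂ p v) * γ₂ p.2 a.2 b.2 +
  2 * (partialS (partialS f) (normPair γ₁ γ₂ p v) * (γ₁ p.1 v.1 a.1 * γ₁ p.1 v.1 b.1) +
    partialT (partialS f) (normPair γ₁ γ₂ p v) *
      (γ₁ p.1 v.1 a.1 * γ₂ p.2 v.2 b.2 + γ₂ p.2 v.2 a.2 * γ₁ p.1 v.1 b.1) +
    partialT (partialT f) (normPair γ₁ γ₂ p v) * (γ₂ p.2 v.2 a.2 * γ₂ p.2 v.2 b.2))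

lemma productForm_smul_left (f : ℝ × ℝ → ℝ) (γ₁ : E₁ → E₁ →L[ℝ] E₁ →L[ℝ] ℝ)
    (γ₂ : E₂ → E₂ →L[ℝ] E₂ →L[ℝ] ℝ) (p v : E₁ × E₂) (r : ℝ) (a b : E₁ × E₂) :
    productForm f γ₁ γ₂ p v (r • a) b = r * productForm f γ₁ γ₂ p v a b := by
  simp only [productForm, Prod.smul_fst, Prod.smul_snd, map_smul, smul_apply, smul_eq_mul]
  ring

/-- The direct sum of two families of bilinear maps. -/
def prodBilin (A : E₁ →L[ℝ] E₁ →L[ℝ] E₁) (B : E₂ →L[ℝ] E₂ →L[ℝ] E₂) :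
    E₁ × E₂ →L[ℝ] E₁ × E₂ →L[ℝ] E₁ × E₂ :=
  (ContinuousLinearMap.compL ℝ (E₁ × E₂) E₁ (E₁ × E₂) (ContinuousLinearMap.inl ℝ E₁ E₂)).comp
    (((ContinuousLinearMap.compL ℝ (E₁ × E₂) E₁ E₁).flip (ContinuousLinearMap.fst ℝ E₁ E₂)).comp
      (A.comp (ContinuousLinearMap.fst ℝ E₁ E₂))) +
  (ContinuousLinearMap.compL ℝ (E₁ × E₂) E₂ (E₁ × E₂) (ContinuousLinearMap.inr ℝ E₁ E₂)).comp
    (((ContinuousLinearMap.compL ℝ (E₁ × E₂) E₂ E₂).flip (ContinuousLinearMap.snd ℝ E₁ E₂)).comp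
      (B.comp (ContinuousLinearMap.snd ℝ E₁ E₂)))

lemma prodBilin_apply (A : E₁ →L[ℝ] E₁ →L[ℝ] E₁) (B : E₂ →L[ℝ] E₂ →L[ℝ] E₂) (a b : E₁ × E₂) :
    prodBilin A B a b = (A a.1 b.1, B a.2 b.2) := by
  simp [prodBilin]

/-- The direct sum of the Christoffel symbols. -/
def prodChristoffel (γ₁ : E₁ → E₁ →L[ℝ] E₁ →L[ℝ] ℝ) (γ₂ : E₂ → E₂ →L[ℝ] E₂ →L[ℝ] ℝ)
    (q : E₁ × E₂) : E₁ × E₂ →L[ℝ] E₁ × E₂ →L[ℝ] E₁ × E₂ :=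
  prodBilin (christoffelCLM γ₁ q.1) (christoffelCLM γ₂ q.2)

lemma prodChristoffel_apply (γ₁ : E₁ → E₁ →L[ℝ] E₁ →L[ℝ] ℝ) (γ₂ : E₂ → E₂ →L[ℝ] E₂ →L[ℝ] ℝ)
    (q a b : E₁ × E₂) : prodChristoffel γ₁ γ₂ q a b =
      (christoffelCLM γ₁ q.1 a.1 b.1, christoffelCLM γ₂ q.2 a.2 b.2) :=
  prodBilin_apply _ _ _ _

namespace IsProductOn

variable {f : ℝ × ℝ → ℝ} {γ₁ : E₁ → E₁ →L[ℝ] E₁ →L[ℝ] ℝ} {U₁ : Set E₁}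
  {γ₂ : E₂ → E₂ →L[ℝ] E₂ →L[ℝ] ℝ} {U₂ : Set E₂} {L : E₁ × E₂ → E₁ × E₂ → ℝ} {p v : E₁ × E₂}

lemma isOpen (h : IsProductOn f γ₁ U₁ γ₂ U₂ L) : IsOpen (U₁ ×ˢ U₂) :=
  h.metric₁.isOpen.prod h.metric₂.isOpen

lemma normPair_mem (h : IsProductOn f γ₁ U₁ γ₂ U₂ L) (hp : p ∈ U₁ ×ˢ U₂) (v : E₁ × E₂) :
    normPair γ₁ γ₂ p v ∈ quadrant :=
  ⟨h.metric₁.nonneg hp.1 _, h.metric₂.nonneg hp.2 _⟩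

lemma normPair_ne_zero (h : IsProductOn f γ₁ U₁ γ₂ U₂ L) (hp : p ∈ U₁ ×ˢ U₂) (hv : v ≠ 0) :
    normPair γ₁ γ₂ p v ≠ 0 := by
  intro h0
  have h1 := Prod.ext_iff.1 h0
  exact hv (Prod.ext (h.metric₁.eq_zero hp.1 h1.1) (h.metric₂.eq_zero hp.2 h1.2))

lemma sq_eq (h : IsProductOn f γ₁ U₁ γ₂ U₂ L) (hp : p ∈ U₁ ×ˢ U₂) (v : E₁ × E₂) :
    L p v ^ 2 = f (γ₁ p.1 v.1 v.1, γ₂ p.2 v.2 v.2) := by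
  rw [h.eq_sqrt p hp, Real.sq_sqrt (h.profile.nonneg _ (h.normPair_mem hp v))]
  rfl

/-- Joint smoothness in position and velocity holds off the zero section, even where one component
of `v` vanishes, since only the pair `(α₁², α₂²)` must avoid the origin. It legitimises computing
derivatives along lines only. -/
lemma contDiffAt_sq (h : IsProductOn f γ₁ U₁ γ₂ U₂ L) (hp : p ∈ U₁ ×ˢ U₂) (hv : v ≠ 0) :
    ContDiffAt ℝ ∞ (fun z : (E₁ × E₂) × (E₁ × E₂) => L z.1 z.2 ^ 2) (p, v) := by
  have hU : ∀ᶠ z : (E₁ × E₂) × (E₁ × E₂) in nhds (p, v), z.1 ∈ U₁ ×ˢ U₂ :=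
    continuous_fst.continuousAt.eventually_mem (h.isOpen.mem_nhds hp)
  have h1 : ContDiffAt ℝ ∞ (fun z : (E₁ × E₂) × (E₁ × E₂) => γ₁ z.1.1 z.2.1 z.2.1) (p, v) := by
    have a1 : ContDiffAt ℝ ∞ (fun z : (E₁ × E₂) × (E₁ × E₂) => γ₁ z.1.1) (p, v) :=
      ContDiffAt.comp (p, v) (f := fun z : (E₁ × E₂) × (E₁ × E₂) => z.1.1)
        (h.metric₁.contDiffAt hp.1) (by fun_prop)
    exact (a1.clm_apply (by fun_prop)).clm_apply (by fun_prop)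
  have h2 : ContDiffAt ℝ ∞ (fun z : (E₁ × E₂) × (E₁ × E₂) => γ₂ z.1.2 z.2.2 z.2.2) (p, v) := by
    have a1 : ContDiffAt ℝ ∞ (fun z : (E₁ × E₂) × (E₁ × E₂) => γ₂ z.1.2) (p, v) :=
      ContDiffAt.comp (p, v) (f := fun z : (E₁ × E₂) × (E₁ × E₂) => z.1.2)
        (h.metric₂.contDiffAt hp.2) (by fun_prop)
    exact (a1.clm_apply (by fun_prop)).clm_apply (by fun_prop)
  have h3 := h.profile.smoothOffOrigin.contDiffAt_comp h1 h2
    (hU.mono fun z hz => h.normPair_mem hz z.2) (h.normPair_ne_zero hp hv)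
  exact h3.congr_of_eventuallyEq (hU.mono fun z hz => h.sq_eq hz z.2)

lemma contDiffAt_fderiv_sq (h : IsProductOn f γ₁ U₁ γ₂ U₂ L) (hp : p ∈ U₁ ×ˢ U₂) (hv : v ≠ 0) :
    ContDiffAt ℝ ∞ (fun z : (E₁ × E₂) × (E₁ × E₂) => fderiv ℝ (fun w => L z.1 w ^ 2) z.2)
      (p, v) := by
  refine ContDiffAt.fderiv (n := ∞) (f := fun (z : (E₁ × E₂) × (E₁ × E₂)) w => L z.1 w ^ 2)
    ?_ contDiffAt_snd (by simp)
  exact ContDiffAt.comp ((p, v), v)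
    (f := fun x : ((E₁ × E₂) × (E₁ × E₂)) × (E₁ × E₂) => (x.1.1, x.2))
    (h.contDiffAt_sq hp hv) (by fun_prop)

lemma contDiffAt_fundCoord (h : IsProductOn f γ₁ U₁ γ₂ U₂ L) (hp : p ∈ U₁ ×ˢ U₂) (hv : v ≠ 0) :
    ContDiffAt ℝ ∞ (fun z : (E₁ × E₂) × (E₁ × E₂) => fundCoord L z.1 z.2) (p, v) := by
  refine ContDiffAt.const_smul (1 / 2 : ℝ) (ContDiffAt.fderiv (n := ∞)
    (f := fun (z : (E₁ × E₂) × (E₁ × E₂)) w => fderiv ℝ (fun w => L z.1 w ^ 2) w)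
    ?_ contDiffAt_snd (by simp))
  exact ContDiffAt.comp ((p, v), v)
    (f := fun x : ((E₁ × E₂) × (E₁ × E₂)) × (E₁ × E₂) => (x.1.1, x.2))
    (h.contDiffAt_fderiv_sq hp hv) (by fun_prop)

variable [FiniteDimensional ℝ E₁] [FiniteDimensional ℝ E₂]

/-- The derivative of `h(α₁², α₂²)` along a curve in the tangent bundle. -/
lemma hasDerivAt_comp_normPair (h : IsProductOn f γ₁ U₁ γ₂ U₂ L) {k : ℝ × ℝ → ℝ}
    (hk : SmoothOffOrigin k) {c W : ℝ → E₁ × E₂} {c' W' : E₁ × E₂} {t : ℝ}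
    (hp : c t ∈ U₁ ×ˢ U₂) (hv : W t ≠ 0) (hc : HasDerivAt c c' t) (hW : HasDerivAt W W' t) :
    HasDerivAt (fun r => k (normPair γ₁ γ₂ (c r) (W r)))
      (2 * (partialS k (normPair γ₁ γ₂ (c t) (W t)) *
          γ₁ (c t).1 (W t).1 (W' + prodChristoffel γ₁ γ₂ (c t) c' (W t)).1 +
        partialT k (normPair γ₁ γ₂ (c t) (W t)) *
          γ₂ (c t).2 (W t).2 (W' + prodChristoffel γ₁ γ₂ (c t) c' (W t)).2)) t := by
  have h1 := h.metric₁.hasDerivAt_apply hp.1 hc.fst hW.fst hW.fst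
  have h2 := h.metric₂.hasDerivAt_apply hp.2 hc.snd hW.snd hW.snd
  have hU : ∀ᶠ r in nhds t, c r ∈ U₁ ×ˢ U₂ :=
    hc.continuousAt.eventually_mem (h.isOpen.mem_nhds hp)
  have h3 := hk.hasDerivAt_comp h1 h2 (hU.mono fun r hr => h.normPair_mem hr (W r))
    (h.normPair_ne_zero hp hv)
  refine h3.congr_deriv ?_
  rw [h.metric₁.symm _ hp.1 (W'.1 + _), h.metric₂.symm _ hp.2 (W'.2 + _), prodChristoffel_apply]
  simp only [normPair, Prod.fst_add, Prod.snd_add]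
  ring

lemma fderiv_sq_apply (h : IsProductOn f γ₁ U₁ γ₂ U₂ L) (hp : p ∈ U₁ ×ˢ U₂) (hv : v ≠ 0)
    (b : E₁ × E₂) : fderiv ℝ (fun w => L p w ^ 2) v b = 2 * productLegendre f γ₁ γ₂ p v b := by
  have h0 : DifferentiableAt ℝ (fun w => L p w ^ 2) v :=
    (ContDiffAt.comp v (f := fun w : E₁ × E₂ => (p, w)) (h.contDiffAt_sq hp hv)
      (by fun_prop)).differentiableAt (by simp)
  have h1 := h.hasDerivAt_comp_normPair (c := fun _ => p) (W := fun r : ℝ => v + r • b) (t := 0)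
    h.profile.smoothOffOrigin hp (by simpa using hv) (hasDerivAt_const _ _) (hasDerivAt_line v b)
  have h2 : HasDerivAt (fun r : ℝ => L p (v + r • b) ^ 2)
      (fderiv ℝ (fun w => L p w ^ 2) v b) 0 :=
    h0.hasFDerivAt.hasLineDerivAt b
  have h3 := h1.congr_of_eventuallyEq (f₁ := fun r : ℝ => L p (v + r • b) ^ 2)
    (Filter.Eventually.of_forall fun r => h.sq_eq hp _)
  rw [h2.unique h3]
  simp [productLegendre]

/-- The derivative of the Legendre transform along a curve in the tangent bundle. -/
lemma hasDerivAt_legendre (h : IsProductOn f γ₁ U₁ γ₂ U₂ L) {c W : ℝ → E₁ × E₂}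
    {c' W' : E₁ × E₂} {t : ℝ} (hp : c t ∈ U₁ ×ˢ U₂) (hv : W t ≠ 0) (hc : HasDerivAt c c' t)
    (hW : HasDerivAt W W' t) (b : E₁ × E₂) :
    HasDerivAt (fun r => productLegendre f γ₁ γ₂ (c r) (W r) b)
      (productForm f γ₁ γ₂ (c t) (W t) (W' + prodChristoffel γ₁ γ₂ (c t) c' (W t)) b +
        productLegendre f γ₁ γ₂ (c t) (W t) (prodChristoffel γ₁ γ₂ (c t) c' b)) t := by
  have hf := h.profile.smoothOffOrigin
  have hS := h.hasDerivAt_comp_normPair hf.partialS hp hv hc hW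
  have hT := h.hasDerivAt_comp_normPair hf.partialT hp hv hc hW
  have h1 := h.metric₁.hasDerivAt_apply hp.1 hc.fst hW.fst (hasDerivAt_const t b.1)
  have h2 := h.metric₂.hasDerivAt_apply hp.2 hc.snd hW.snd (hasDerivAt_const t b.2)
  refine ((hS.mul h1).add (hT.mul h2)).congr_deriv ?_
  rw [hf.partialS_partialT (h.normPair_mem hp _) (h.normPair_ne_zero hp hv)]
  simp only [productForm, productLegendre, prodChristoffel_apply, Prod.fst_add, Prod.snd_add,
    zero_add]
  ring

/-- This is the derivative of the Legendre transform along a vertical line: the base point is fixed,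
so every Christoffel term vanishes. -/
lemma fundCoord_apply (h : IsProductOn f γ₁ U₁ γ₂ U₂ L) (hp : p ∈ U₁ ×ˢ U₂) (hv : v ≠ 0)
    (a b : E₁ × E₂) : fundCoord L p v a b = productForm f γ₁ γ₂ p v a b := by
  have h0 : DifferentiableAt ℝ (fderiv ℝ (fun w => L p w ^ 2)) v :=
    (ContDiffAt.comp v (f := fun w : E₁ × E₂ => (p, w)) (h.contDiffAt_fderiv_sq hp hv)
      (by fun_prop)).differentiableAt (by simp)
  have h1 := (h.hasDerivAt_legendre (c := fun _ => p) (W := fun r : ℝ => v + r • a) (t := 0) hp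
    (by simpa using hv) (hasDerivAt_const _ _) (hasDerivAt_line v a) b).const_mul 2
  have hne : ∀ᶠ r in nhds (0 : ℝ), v + r • a ≠ 0 :=
    (hasDerivAt_line v a).continuousAt.eventually_ne (by simpa using hv)
  have h2 := h1.congr_of_eventuallyEq
    (f₁ := fun r : ℝ => fderiv ℝ (fun w => L p w ^ 2) (v + r • a) b)
    (hne.mono fun r hr => h.fderiv_sq_apply hp hr b)
  have h3 := fderiv_apply_eq_of_hasDerivAt (c := fun r : ℝ => v + r • a) (t := 0)
    (by simpa using h0) (hasDerivAt_line v a) h2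
  simp only [zero_smul, add_zero] at h3
  rw [fundCoord, smul_apply, smul_apply, h3]
  simp [productLegendre]

/-- Here the base point moves along a line while the velocity is constant in the coordinates, so its
covariant derivative is just the Christoffel term. -/
lemma fderiv_fderiv_sq_apply (h : IsProductOn f γ₁ U₁ γ₂ U₂ L) (hp : p ∈ U₁ ×ˢ U₂) (hv : v ≠ 0)
    (a b : E₁ × E₂) : fderiv ℝ (fun q => fderiv ℝ (fun w => L q w ^ 2) v) p a b =
      2 * (productForm f γ₁ γ₂ p v (prodChristoffel γ₁ γ₂ p a v) b +
        productLegendre f γ₁ γ₂ p v (prodChristoffel γ₁ γ₂ p a b)) := by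
  have h0 : DifferentiableAt ℝ (fun q => fderiv ℝ (fun w => L q w ^ 2) v) p :=
    (ContDiffAt.comp p (f := fun q : E₁ × E₂ => (q, v)) (h.contDiffAt_fderiv_sq hp hv)
      (by fun_prop)).differentiableAt (by simp)
  have h1 := (h.hasDerivAt_legendre (c := fun r : ℝ => p + r • a) (W := fun _ => v) (t := 0)
    (by simpa using hp) hv (hasDerivAt_line p a) (hasDerivAt_const _ _) b).const_mul 2
  have hU : ∀ᶠ r in nhds (0 : ℝ), p + r • a ∈ U₁ ×ˢ U₂ :=
    (hasDerivAt_line p a).continuousAt.eventually_mem (h.isOpen.mem_nhds (by simpa using hp))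
  have h2 := h1.congr_of_eventuallyEq
    (f₁ := fun r : ℝ => fderiv ℝ (fun w => L (p + r • a) w ^ 2) v b)
    (hU.mono fun r hr => h.fderiv_sq_apply hr hv b)
  have h3 := fderiv_apply_eq_of_hasDerivAt (c := fun r : ℝ => p + r • a) (t := 0)
    (Φ := fun q => fderiv ℝ (fun w => L q w ^ 2) v)
    (by simpa using h0) (hasDerivAt_line p a) h2
  simpa using h3

lemma fderiv_base_sq_apply (h : IsProductOn f γ₁ U₁ γ₂ U₂ L) (hp : p ∈ U₁ ×ˢ U₂) (hv : v ≠ 0)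
    (a : E₁ × E₂) : fderiv ℝ (fun q => L q v ^ 2) p a =
      2 * productLegendre f γ₁ γ₂ p v (prodChristoffel γ₁ γ₂ p a v) := by
  have h0 : DifferentiableAt ℝ (fun q => L q v ^ 2) p :=
    (ContDiffAt.comp p (f := fun q : E₁ × E₂ => (q, v)) (h.contDiffAt_sq hp hv)
      (by fun_prop)).differentiableAt (by simp)
  have h1 := h.hasDerivAt_comp_normPair (c := fun r : ℝ => p + r • a) (W := fun _ => v) (t := 0)
    h.profile.smoothOffOrigin (by simpa using hp) hv (hasDerivAt_line p a) (hasDerivAt_const _ _)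
  have hU : ∀ᶠ r in nhds (0 : ℝ), p + r • a ∈ U₁ ×ˢ U₂ :=
    (hasDerivAt_line p a).continuousAt.eventually_mem (h.isOpen.mem_nhds (by simpa using hp))
  have h2 : HasDerivAt (fun r : ℝ => L (p + r • a) v ^ 2)
      (fderiv ℝ (fun q => L q v ^ 2) p a) 0 :=
    h0.hasFDerivAt.hasLineDerivAt a
  have h3 := h1.congr_of_eventuallyEq (f₁ := fun r : ℝ => L (p + r • a) v ^ 2)
    (hU.mono fun r hr => h.sq_eq hr v)
  rw [h2.unique h3]
  simp [productLegendre]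

end IsProductOn

end ProductCoordinates

/-! ### The fundamental tensor as a binary quadratic form -/

section Algebra

/-- In the application `A, B` are `f_s, f_t`; `P, Q, R` are `f_ss, f_st, f_tt`; `x, y` are the
squared lengths of the components of `u`; and `a, b` are their inner products with those of `v`, so
the last two hypotheses are Cauchy–Schwarz. Off the axes, replacing `x`, `y` by their lower bounds
leaves a binary form with positive leading coefficient and determinant a positive multiple of `A B -
2 f Q`, where Euler's relation gives `f = s A + t B`. -/
lemma binary_form_pos {s t A B P Q R x y a b : ℝ} (hs : 0 ≤ s) (ht : 0 ≤ t)
    (hst : s ≠ 0 ∨ t ≠ 0) (hA : 0 < A) (hB : 0 < B) (h1 : s * P + t * Q = 0)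
    (h2 : s * Q + t * R = 0) (hα : 0 < A + 2 * s * P) (hβ : 0 < B + 2 * t * R)
    (hD : 0 < A * B - 2 * (s * A + t * B) * Q) (hx : 0 ≤ x) (hy : 0 ≤ y)
    (hxy : x ≠ 0 ∨ y ≠ 0) (ha : a ^ 2 ≤ s * x) (hb : b ^ 2 ≤ t * y) :
    0 < A * x + B * y + 2 * (P * (a * a) + Q * (a * b + b * a) + R * (b * b)) := by
  have hxy' : 0 < A * x + B * y := by
    rcases hxy with h | h
    · have := mul_pos hA (lt_of_le_of_ne hx h.symm)
      have := mul_nonneg hB.le hy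
      linarith
    · have := mul_pos hB (lt_of_le_of_ne hy h.symm)
      have := mul_nonneg hA.le hx
      linarith
  -- On an axis Cauchy–Schwarz kills one inner product and Euler's relations kill the second
  -- derivative multiplying the square of the other; only `A x + B y` survives.
  rcases hs.eq_or_lt with rfl | hs'
  · have ht' : t ≠ 0 := by simpa using hst
    have ha0 : a = 0 := by nlinarith
    have hR : R = 0 := by simpa [ht'] using h2
    simpa [ha0, hR] using hxy'
  rcases ht.eq_or_lt with rfl | ht'
  · have hb0 : b = 0 := by nlinarith
    have hP : P = 0 := by simpa [hs'.ne'] using h1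
    simpa [hb0, hP] using hxy'
  obtain ⟨a, rfl⟩ : ∃ a', a = s * a' := ⟨a / s, by field_simp⟩
  obtain ⟨b, rfl⟩ : ∃ b', b = t * b' := ⟨b / t, by field_simp⟩
  have hx' : s * a ^ 2 ≤ x := le_of_mul_le_mul_left (by linarith) hs'
  have hy' : t * b ^ 2 ≤ y := le_of_mul_le_mul_left (by linarith) ht'
  by_cases h0 : a = 0 ∧ b = 0
  · simpa [h0.1, h0.2] using hxy'
  have hP : s * P = -(t * Q) := by linarith
  have hR : t * R = -(s * Q) := by linarith
  set α := A + 2 * s * P with hαdef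
  set β := B + 2 * t * R with hβdef
  have hαβ : 0 < α * β - 4 * s * t * Q ^ 2 := by
    have e1 : α = A - 2 * t * Q := by linarith
    have e2 : β = B - 2 * s * Q := by linarith
    rw [e1, e2]
    linarith
  have key : 0 < s * α * a ^ 2 + 4 * Q * s * t * a * b + t * β * b ^ 2 := by
    have hsα := mul_pos hs' hα
    refine pos_of_mul_pos_right (a := s * α) ?_ hsα.le
    -- Completing the square, after multiplication by the leading coefficient `s α`.
    have e : s * α * (s * α * a ^ 2 + 4 * Q * s * t * a * b + t * β * b ^ 2) =
        (s * α * a + 2 * Q * s * t * b) ^ 2 + s * t * (α * β - 4 * s * t * Q ^ 2) * b ^ 2 := by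
      ring
    rw [e]
    by_cases hb0 : b = 0
    · have ha0 : a ≠ 0 := fun h => h0 ⟨h, hb0⟩
      simp only [hb0, mul_zero, add_zero]
      positivity
    · have : 0 < s * t * (α * β - 4 * s * t * Q ^ 2) * b ^ 2 := by positivity
      positivity
  have e : A * (s * a ^ 2) + B * (t * b ^ 2) + 2 * (P * (s * a * (s * a)) +
      Q * (s * a * (t * b) + t * b * (s * a)) + R * (t * b * (t * b))) =
      s * α * a ^ 2 + 4 * Q * s * t * a * b + t * β * b ^ 2 := by
    rw [hαdef, hβdef]; ring
  have := mul_le_mul_of_nonneg_left hx' hA.le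
  have := mul_le_mul_of_nonneg_left hy' hB.le
  linarith

end Algebra

/-! ### Cauchy–Schwarz for positive forms -/

section Metric

variable {E : Type*} [NormedAddCommGroup E] [NormedSpace ℝ E]
  {γ : E → E →L[ℝ] E →L[ℝ] ℝ} {U : Set E} {p : E}

/-- The vector is `B v v` times the component of `u` orthogonal to `v`; its square contains the
Cauchy–Schwarz defect as a factor, which yields both the weak and the strict inequality. -/
lemma form_combination {B : E →L[ℝ] E →L[ℝ] ℝ} (hs : ∀ v w, B v w = B w v) (v u : E) :
    B (B v v • u - B v u • v) (B v v • u - B v u • v) = B v v * (B v v * B u u - B v u ^ 2) := by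
  simp only [map_sub, map_smul, sub_apply, smul_apply, smul_eq_mul, hs u v]
  ring

lemma form_cauchySchwarz {B : E →L[ℝ] E →L[ℝ] ℝ} (hs : ∀ v w, B v w = B w v)
    (hp : ∀ v, v ≠ 0 → 0 < B v v) (v u : E) : B v u ^ 2 ≤ B v v * B u u := by
  by_cases hv : v = 0
  · simp [hv]
  have h1 : 0 ≤ B (B v v • u - B v u • v) (B v v • u - B v u • v) := by
    by_cases h : B v v • u - B v u • v = 0
    · simp [h]
    · exact (hp _ h).le
  rw [form_combination hs] at h1
  linarith [nonneg_of_mul_nonneg_right h1 (hp v hv)]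

lemma form_cauchySchwarz_lt {B : E →L[ℝ] E →L[ℝ] ℝ} (hs : ∀ v w, B v w = B w v)
    (hp : ∀ v, v ≠ 0 → 0 < B v v) {v u : E} (hv : v ≠ 0) (hu : ∀ c : ℝ, c • v ≠ u) :
    B v u ^ 2 < B v v * B u u := by
  have h0 := hp v hv
  have h1 := hp (B v v • u - B v u • v) (fun h => hu ((B v v)⁻¹ * B v u) (by
    rw [mul_smul, ← sub_eq_zero.1 h, smul_smul, inv_mul_cancel₀ h0.ne', one_smul]))
  rw [form_combination hs] at h1
  linarith [pos_of_mul_pos_right h1 h0.le]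

lemma IsMetricOn.cauchySchwarz (hγ : IsMetricOn γ U) (hp : p ∈ U) (v u : E) :
    γ p v u ^ 2 ≤ γ p v v * γ p u u :=
  form_cauchySchwarz (hγ.symm p hp) (hγ.pos p hp) v u

lemma IsMetricOn.exists_apply_self_eq [Nontrivial E] (hγ : IsMetricOn γ U) (hp : p ∈ U) {s : ℝ}
    (hs : 0 ≤ s) : ∃ v, γ p v v = s := by
  obtain ⟨w, hw⟩ := exists_ne (0 : E)
  have h := hγ.pos p hp w hw
  refine ⟨Real.sqrt (s / γ p w w) • w, ?_⟩
  simp only [map_smul, smul_apply, smul_eq_mul]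
  rw [← mul_assoc, Real.mul_self_sqrt (by positivity), div_mul_cancel₀ _ h.ne']

end Metric

/-! ### Convexity conditions, spray, curvature and Chern connection of the product -/

section ProductCoordinates

variable {E₁ : Type*} [NormedAddCommGroup E₁] [NormedSpace ℝ E₁]
  {E₂ : Type*} [NormedAddCommGroup E₂] [NormedSpace ℝ E₂]

variable {f : ℝ × ℝ → ℝ} {γ₁ : E₁ → E₁ →L[ℝ] E₁ →L[ℝ] ℝ} {U₁ : Set E₁}
  {γ₂ : E₂ → E₂ →L[ℝ] E₂ →L[ℝ] ℝ} {U₂ : Set E₂} {L : E₁ × E₂ → E₁ × E₂ → ℝ} {p v : E₁ × E₂}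

namespace IsProductOn

lemma productForm_comm (h : IsProductOn f γ₁ U₁ γ₂ U₂ L) (hp : p ∈ U₁ ×ˢ U₂)
    (v a b : E₁ × E₂) : productForm f γ₁ γ₂ p v a b = productForm f γ₁ γ₂ p v b a := by
  rw [productForm, productForm, h.metric₁.symm _ hp.1 a.1, h.metric₂.symm _ hp.2 a.2]
  ring

lemma productForm_self_pos (h : IsProductOn f γ₁ U₁ γ₂ U₂ L) (hf : ConvexityConditions f)
    (hp : p ∈ U₁ ×ˢ U₂) (hv : v ≠ 0) {u : E₁ × E₂} (hu : u ≠ 0) :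
    0 < productForm f γ₁ γ₂ p v u u := by
  have hq := h.normPair_mem hp v
  have hq0 := h.normPair_ne_zero hp hv
  obtain ⟨c1, c2, c3, c4, c5⟩ := hf _ hq hq0
  have hu' := h.normPair_ne_zero hp hu
  have ne_or : ∀ q : ℝ × ℝ, q ≠ 0 → q.1 ≠ 0 ∨ q.2 ≠ 0 := fun q hq => by
    by_contra hc
    push Not at hc
    exact hq (Prod.ext hc.1 hc.2)
  rw [← h.profile.euler hq hq0] at c5
  exact binary_form_pos hq.1 hq.2 (ne_or _ hq0) c1 c2
    (h.profile.euler_S hq hq0) (h.profile.euler_T hq hq0) c3 c4 c5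
    (h.normPair_mem hp u).1 (h.normPair_mem hp u).2 (ne_or _ hu')
    (h.metric₁.cauchySchwarz hp.1 _ _) (h.metric₂.cauchySchwarz hp.2 _ _)

/-- A single base point suffices: when both factors have positive dimension, every point of the
quadrant is the pair of squared lengths of some tangent vector there. -/
lemma convexityConditions [Nontrivial E₁] [Nontrivial E₂] (h : IsProductOn f γ₁ U₁ γ₂ U₂ L)
    (hp : p ∈ U₁ ×ˢ U₂)
    (hpos : ∀ v u : E₁ × E₂, v ≠ 0 → u ≠ 0 → 0 < productForm f γ₁ γ₂ p v u u) :
    ConvexityConditions f := by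
  have hf := h.profile.smoothOffOrigin
  have main : ∀ q ∈ quadrant, q ≠ 0 → ∃ v : E₁ × E₂, v ≠ 0 ∧ γ₁ p.1 v.1 v.1 = q.1 ∧
      γ₂ p.2 v.2 v.2 = q.2 := by
    intro q hq hq0
    obtain ⟨v₁, hv₁⟩ := h.metric₁.exists_apply_self_eq hp.1 hq.1
    obtain ⟨v₂, hv₂⟩ := h.metric₂.exists_apply_self_eq hp.2 hq.2
    refine ⟨(v₁, v₂), ?_, hv₁, hv₂⟩
    rintro h0
    obtain ⟨rfl, rfl⟩ := Prod.ext_iff.1 h0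
    exact hq0 (Prod.ext (by simpa using hv₁.symm) (by simpa using hv₂.symm))
  obtain ⟨e₁, he₁⟩ := h.metric₁.exists_apply_self_eq hp.1 zero_le_one
  obtain ⟨e₂, he₂⟩ := h.metric₂.exists_apply_self_eq hp.2 zero_le_one
  have he₁0 : e₁ ≠ 0 := by rintro rfl; simp at he₁
  have he₂0 : e₂ ≠ 0 := by rintro rfl; simp at he₂
  -- The test vector is `(v.1, 0)`, which gives `s (f_s + 2 s f_ss)`. At `s = 0` it is zero, and a
  -- unit vector of the first factor replaces it.
  have c3 : ∀ q ∈ quadrant, q ≠ 0 → 0 < partialS f q + 2 * q.1 * partialS (partialS f) q := by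
    intro q hq hq0
    obtain ⟨v, hv, hv₁, hv₂⟩ := main q hq hq0
    by_cases hs : q.1 = 0
    · have hv0 : v.1 = 0 := h.metric₁.eq_zero hp.1 (hv₁.trans hs)
      have := hpos v (e₁, 0) hv (by simp [he₁0])
      simp only [productForm, normPair, hv₂, he₁, hv0, map_zero, zero_apply] at this
      have hq' : ((0 : ℝ), q.2) = q := Prod.ext hs.symm rfl
      simpa [hs, hq'] using this
    · have hv0 : v.1 ≠ 0 := by intro h0; simp [h0] at hv₁; exact hs hv₁.symm
      have := hpos v (v.1, 0) hv (by simp [hv0])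
      simp only [productForm, normPair, hv₁, hv₂, map_zero, mul_zero, add_zero] at this
      exact pos_of_mul_pos_right (a := q.1) (by linarith) hq.1
  have c4 : ∀ q ∈ quadrant, q ≠ 0 → 0 < partialT f q + 2 * q.2 * partialT (partialT f) q := by
    intro q hq hq0
    obtain ⟨v, hv, hv₁, hv₂⟩ := main q hq hq0
    by_cases hs : q.2 = 0
    · have hv0 : v.2 = 0 := h.metric₂.eq_zero hp.2 (hv₂.trans hs)
      have := hpos v (0, e₂) hv (by simp [he₂0])
      simp only [productForm, normPair, hv₁, he₂, hv0, map_zero, zero_apply] at this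
      have hq' : (q.1, (0 : ℝ)) = q := Prod.ext rfl hs.symm
      simpa [hs, hq'] using this
    · have hv0 : v.2 ≠ 0 := by intro h0; simp [h0] at hv₂; exact hs hv₂.symm
      have := hpos v (0, v.2) hv (by simp [hv0])
      simp only [productForm, normPair, hv₁, hv₂, map_zero, mul_zero, add_zero, zero_add,
        zero_mul] at this
      exact pos_of_mul_pos_right (a := q.2) (by linarith) hq.2
  have c1 : ∀ q ∈ quadrant, q ≠ 0 → 0 < partialS f q := by
    intro q hq hq0
    rcases hq.2.eq_or_lt with ht | ht
    · have h1 := h.profile.euler hq hq0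
      rw [← ht, zero_mul, add_zero] at h1
      exact pos_of_mul_pos_right (h1.symm ▸ h.profile.pos hq hq0) hq.1
    rcases hq.1.eq_or_lt with hs | hs
    · simpa [← hs] using c3 q hq hq0
    -- The derivative of `r f_s(r², t)` is the left side of the third condition at `(r², t)`. Hence
    -- this function increases strictly from its value `0` at `r = 0`, and `r = √s` gives `f_s > 0`.
    have hd : ∀ x : ℝ, HasDerivAt (fun r : ℝ => r * partialS f (r ^ 2, q.2))
        (partialS f (x ^ 2, q.2) + 2 * x ^ 2 * partialS (partialS f) (x ^ 2, q.2)) x := by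
      intro x
      have h1 := hf.partialS.hasDerivAt_comp (hasDerivAt_pow 2 x) (hasDerivAt_const x q.2)
        (Filter.Eventually.of_forall fun z => ⟨sq_nonneg z, hq.2⟩) (by simp [ht.ne'])
      refine ((hasDerivAt_id x).mul h1).congr_deriv ?_
      simp only [id, Nat.cast_ofNat]
      ring
    have hm : StrictMono (fun r : ℝ => r * partialS f (r ^ 2, q.2)) := by
      refine strictMono_of_deriv_pos fun x => ?_
      rw [(hd x).deriv]
      exact c3 (x ^ 2, q.2) ⟨sq_nonneg x, hq.2⟩ (by simp [ht.ne'])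
    have h2 := hm (Real.sqrt_pos.2 hs)
    simp only [zero_mul, Real.sq_sqrt hq.1] at h2
    exact pos_of_mul_pos_right h2 (Real.sqrt_nonneg _)
  have c2 : ∀ q ∈ quadrant, q ≠ 0 → 0 < partialT f q := by
    intro q hq hq0
    rcases hq.1.eq_or_lt with hs | hs
    · have h1 := h.profile.euler hq hq0
      rw [← hs, zero_mul, zero_add] at h1
      exact pos_of_mul_pos_right (h1.symm ▸ h.profile.pos hq hq0) hq.2
    rcases hq.2.eq_or_lt with ht | ht
    · simpa [← ht] using c4 q hq hq0
    have hd : ∀ x : ℝ, HasDerivAt (fun r : ℝ => r * partialT f (q.1, r ^ 2))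
        (partialT f (q.1, x ^ 2) + 2 * x ^ 2 * partialT (partialT f) (q.1, x ^ 2)) x := by
      intro x
      have h1 := hf.partialT.hasDerivAt_comp (hasDerivAt_const x q.1) (hasDerivAt_pow 2 x)
        (Filter.Eventually.of_forall fun z => ⟨hq.1, sq_nonneg z⟩) (by simp [hs.ne'])
      refine ((hasDerivAt_id x).mul h1).congr_deriv ?_
      simp only [id, Nat.cast_ofNat]
      ring
    have hm : StrictMono (fun r : ℝ => r * partialT f (q.1, r ^ 2)) := by
      refine strictMono_of_deriv_pos fun x => ?_
      rw [(hd x).deriv]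
      exact c4 (q.1, x ^ 2) ⟨hq.1, sq_nonneg x⟩ (by simp [hs.ne'])
    have h2 := hm (Real.sqrt_pos.2 ht)
    simp only [zero_mul, Real.sq_sqrt hq.2] at h2
    exact pos_of_mul_pos_right h2 (Real.sqrt_nonneg _)
  intro q hq hq0
  refine ⟨c1 q hq hq0, c2 q hq hq0, c3 q hq hq0, c4 q hq hq0, ?_⟩
  have hS := h.profile.euler_S hq hq0
  have hT := h.profile.euler_T hq hq0
  have hE := h.profile.euler hq hq0
  have hST := mul_pos (c1 q hq hq0) (c2 q hq hq0)
  rcases hq.1.eq_or_lt with hs | hs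
  · have ht : q.2 ≠ 0 := fun h0 => hq0 (Prod.ext hs.symm h0)
    have : partialT (partialS f) q = 0 := by simpa [← hs, ht] using hS
    simpa [this] using hST
  rcases hq.2.eq_or_lt with ht | ht
  · have : partialT (partialS f) q = 0 := by simpa [← ht, hs.ne'] using hT
    simpa [this] using hST
  -- On multiples `(x v.1, y v.2)` the form is `s α x² + 4 s t Q x y + t β y²`. For given `y` it is
  -- smallest at `x = -2 t Q y / α`; taking `y = α` gives the value `α t (α β - 4 s t Q²)`, and the
  -- bracket is the fifth expression.
  obtain ⟨v, hv, hv₁, hv₂⟩ := main q hq hq0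
  have hv₁0 : v.1 ≠ 0 := by intro h0; simp [h0] at hv₁; exact hs.ne hv₁
  set α := partialS f q + 2 * q.1 * partialS (partialS f) q with hα
  set β := partialT f q + 2 * q.2 * partialT (partialT f) q with hβ
  set Q := partialT (partialS f) q with hQ
  have hα0 : 0 < α := c3 q hq hq0
  have h1 := hpos v ((-(2 * q.2 * Q)) • v.1, α • v.2) hv (by
    intro h0
    have h2 := (Prod.ext_iff.1 h0).2
    simp only [Prod.snd_zero, smul_eq_zero, hα0.ne', false_or] at h2
    simp [h2] at hv₂
    exact ht.ne hv₂)
  simp only [productForm, normPair, map_smul, smul_apply, smul_eq_mul, hv₁, hv₂, Prod.mk.eta,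
    ← hQ] at h1
  have e1 : α = partialS f q - 2 * q.2 * Q := by linarith
  have e2 : β = partialT f q - 2 * q.1 * Q := by linarith
  have e3 : α * β - 4 * q.1 * q.2 * Q ^ 2 = partialS f q * partialT f q - 2 * f q * Q := by
    rw [e1, e2, ← hE]; ring
  rw [← e3]
  refine pos_of_mul_pos_right (a := α * q.2) ?_ (mul_pos hα0 ht).le
  refine h1.trans_eq ?_
  rw [show partialS f q = α - 2 * q.1 * partialS (partialS f) q by linarith,
    show partialT f q = β - 2 * q.2 * partialT (partialT f) q by linarith]
  ring

lemma apply_smul (h : IsProductOn f γ₁ U₁ γ₂ U₂ L) (hp : p ∈ U₁ ×ˢ U₂) {r : ℝ} (hr : 0 < r)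
    (w : E₁ × E₂) : L p (r • w) = r * L p w := by
  rw [h.eq_sqrt p hp, h.eq_sqrt p hp]
  have : normPair γ₁ γ₂ p (r • w) = (r ^ 2) • normPair γ₁ γ₂ p w := by
    simp only [normPair, Prod.smul_fst, Prod.smul_snd, map_smul, smul_apply, smul_eq_mul,
      Prod.smul_mk]
    congr 1 <;> ring
  rw [this, h.profile.homogeneous _ (h.normPair_mem hp w) _ (by positivity),
    Real.sqrt_mul (sq_nonneg r), Real.sqrt_sq hr.le]

variable [FiniteDimensional ℝ E₁] [FiniteDimensional ℝ E₂]

lemma isInvertible_fundCoord (h : IsProductOn f γ₁ U₁ γ₂ U₂ L) (hf : ConvexityConditions f)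
    (hp : p ∈ U₁ ×ˢ U₂) (hv : v ≠ 0) : (fundCoord L p v).IsInvertible :=
  isInvertible_of_posDef fun u hu => by
    rw [h.fundCoord_apply hp hv]
    exact h.productForm_self_pos hf hp hv hu

lemma prodChristoffel_symm (h : IsProductOn f γ₁ U₁ γ₂ U₂ L) (hp : p ∈ U₁ ×ˢ U₂)
    (a b : E₁ × E₂) : prodChristoffel γ₁ γ₂ p a b = prodChristoffel γ₁ γ₂ p b a := by
  rw [prodChristoffel_apply, prodChristoffel_apply, h.metric₁.christoffel_symm hp.1,
    h.metric₂.christoffel_symm hp.2]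

/-- The spray of the product metric is the direct sum of the sprays of the factors. -/
lemma sprayCoord_eq (h : IsProductOn f γ₁ U₁ γ₂ U₂ L) (hf : ConvexityConditions f)
    (hp : p ∈ U₁ ×ˢ U₂) (hv : v ≠ 0) :
    sprayCoord L p v = (1 / 2 : ℝ) • prodChristoffel γ₁ γ₂ p v v := by
  rw [sprayCoord]
  refine raise_eq (h.isInvertible_fundCoord hf hp hv) fun b => ?_
  rw [h.fundCoord_apply hp hv, productForm_smul_left]
  simp only [smul_apply, sub_apply, h.fderiv_fderiv_sq_apply hp hv,
    h.fderiv_base_sq_apply hp hv, smul_eq_mul]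
  -- The two Legendre terms, at `Γ(v, b)` and `Γ(b, v)`, now cancel and leave `(1/2) g_v(Γ(v, v),
  -- b)`.
  rw [h.prodChristoffel_symm hp b v]
  ring

lemma differentiableAt_prodChristoffel (h : IsProductOn f γ₁ U₁ γ₂ U₂ L) (hp : p ∈ U₁ ×ˢ U₂) :
    DifferentiableAt ℝ (prodChristoffel γ₁ γ₂) p := by
  have h1 : DifferentiableAt ℝ (fun q : E₁ × E₂ => christoffelCLM γ₁ q.1) p :=
    DifferentiableAt.comp p (h.metric₁.differentiableAt_christoffel hp.1) differentiableAt_fst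
  have h2 : DifferentiableAt ℝ (fun q : E₁ × E₂ => christoffelCLM γ₂ q.2) p :=
    DifferentiableAt.comp p (h.metric₂.differentiableAt_christoffel hp.2) differentiableAt_snd
  unfold prodChristoffel prodBilin
  fun_prop

lemma riemannCoord_eq (h : IsProductOn f γ₁ U₁ γ₂ U₂ L) (hf : ConvexityConditions f)
    (hp : p ∈ U₁ ×ˢ U₂) (hv : v ≠ 0) (u : E₁ × E₂) :
    riemannCoord L p v u = (connectionCurvature (christoffelCLM γ₁) p.1 u.1 v.1,
      connectionCurvature (christoffelCLM γ₂) p.2 u.2 v.2) := by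
  have hC := h.differentiableAt_prodChristoffel hp
  rw [riemannCoord_of_quadratic h.isOpen isOpen_ne hp hv hC
    (fun q hq => h.prodChristoffel_symm hq) (fun q hq w hw => h.sprayCoord_eq hf hq hw)]
  have hd : ∀ a b c : E₁ × E₂, fderiv ℝ (prodChristoffel γ₁ γ₂) p a b c =
      (fderiv ℝ (christoffelCLM γ₁) p.1 a.1 b.1 c.1,
        fderiv ℝ (christoffelCLM γ₂) p.2 a.2 b.2 c.2) := by
    intro a b c
    have h1 := h.metric₁.differentiableAt_christoffel hp.1
    have h2 := h.metric₂.differentiableAt_christoffel hp.2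
    rw [← fderiv_bilin_apply hC, ← fderiv_bilin_apply h1, ← fderiv_bilin_apply h2]
    simp only [prodChristoffel_apply]
    have e1 := (differentiableAt_bilin_apply h1 b.1 c.1).hasFDerivAt.comp p
      (hasFDerivAt_fst (𝕜 := ℝ) (E := E₁) (F := E₂))
    have e2 := (differentiableAt_bilin_apply h2 b.2 c.2).hasFDerivAt.comp p
      (hasFDerivAt_snd (𝕜 := ℝ) (E := E₁) (F := E₂))
    exact congrArg (fun A => A a) (e1.prodMk e2).fderiv
  simp only [connectionCurvature, hd, prodChristoffel_apply]
  rfl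

lemma fderiv_sprayCoord (h : IsProductOn f γ₁ U₁ γ₂ U₂ L) (hf : ConvexityConditions f)
    (hp : p ∈ U₁ ×ˢ U₂) (hv : v ≠ 0) :
    fderiv ℝ (sprayCoord L p) v = prodChristoffel γ₁ γ₂ p v := by
  refine ((hasFDerivAt_half_quadratic (h.prodChristoffel_symm hp) v).congr_of_eventuallyEq
    ?_).fderiv
  filter_upwards [isOpen_ne.mem_nhds hv] with w hw
  exact h.sprayCoord_eq hf hp hw

/-- The fundamental tensor is parallel along horizontal directions. -/
lemma horizontalDerivFund_apply (h : IsProductOn f γ₁ U₁ γ₂ U₂ L) (hf : ConvexityConditions f)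
    (hp : p ∈ U₁ ×ˢ U₂) (hv : v ≠ 0) (a b c : E₁ × E₂) :
    horizontalDerivFund L p v a b c =
      productForm f γ₁ γ₂ p v (prodChristoffel γ₁ γ₂ p a b) c +
        productForm f γ₁ γ₂ p v (prodChristoffel γ₁ γ₂ p a c) b := by
  set N := prodChristoffel γ₁ γ₂ p a v with hN
  have hΨ : DifferentiableAt ℝ (fun z : (E₁ × E₂) × (E₁ × E₂) => fundCoord L z.1 z.2) (p, v) :=
    (h.contDiffAt_fundCoord hp hv).differentiableAt (by simp)
  have e1 : fderiv ℝ (fun q => fundCoord L q v) p a =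
      fderiv ℝ (fun z : (E₁ × E₂) × (E₁ × E₂) => fundCoord L z.1 z.2) (p, v) (a, 0) := by
    have := (HasFDerivAt.comp (f := fun q => (q, v)) p hΨ.hasFDerivAt
      (hasFDerivAt_prodMk_left p v)).fderiv
    exact congrArg (fun A => A a) this
  have e2 : fderiv ℝ (fundCoord L p) v N =
      fderiv ℝ (fun z : (E₁ × E₂) × (E₁ × E₂) => fundCoord L z.1 z.2) (p, v) (0, N) := by
    have := (HasFDerivAt.comp (f := fun w => (p, w)) v hΨ.hasFDerivAt
      (hasFDerivAt_prodMk_right p v)).fderiv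
    exact congrArg (fun A => A N) this
  -- The horizontal derivative is the ordinary derivative of `g` on the tangent bundle in the
  -- direction `(a, -Γ(a, v))`, so it can be computed along a line.
  have e3 : horizontalDerivFund L p v a =
      fderiv ℝ (fun z : (E₁ × E₂) × (E₁ × E₂) => fundCoord L z.1 z.2) (p, v) (a, -N) := by
    rw [horizontalDerivFund, sub_apply, ContinuousLinearMap.comp_apply,
      h.fderiv_sprayCoord hf hp hv, h.prodChristoffel_symm hp v a, ← hN, e1, e2, ← map_sub]
    simp
  have hc := hasDerivAt_line p a
  have hW := hasDerivAt_line v (-N)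
  have hp0 : p + (0 : ℝ) • a ∈ U₁ ×ˢ U₂ := by simpa using hp
  have hv0 : v + (0 : ℝ) • (-N) ≠ 0 := by simpa using hv
  have hs := h.profile.smoothOffOrigin
  have d1 := h.hasDerivAt_comp_normPair hs.partialS hp0 hv0 hc hW
  have d2 := h.hasDerivAt_comp_normPair hs.partialT hp0 hv0 hc hW
  have d3 := h.hasDerivAt_comp_normPair hs.partialS.partialS hp0 hv0 hc hW
  have d4 := h.hasDerivAt_comp_normPair hs.partialS.partialT hp0 hv0 hc hW
  have d5 := h.hasDerivAt_comp_normPair hs.partialT.partialT hp0 hv0 hc hW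
  have i1 := h.metric₁.hasDerivAt_apply hp0.1 hc.fst (hasDerivAt_const 0 b.1)
    (hasDerivAt_const 0 c.1)
  have i2 := h.metric₂.hasDerivAt_apply hp0.2 hc.snd (hasDerivAt_const 0 b.2)
    (hasDerivAt_const 0 c.2)
  have j1 := fun b : E₁ × E₂ => h.metric₁.hasDerivAt_apply hp0.1 hc.fst hW.fst
    (hasDerivAt_const 0 b.1)
  have j2 := fun b : E₁ × E₂ => h.metric₂.hasDerivAt_apply hp0.2 hc.snd hW.snd
    (hasDerivAt_const 0 b.2)
  -- The moving vector has zero covariant derivative at the initial time. So the coefficients built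
  -- from `f` are stationary, and only the fixed slots `b` and `c` contribute.
  have hz : (-N + prodChristoffel γ₁ γ₂ p a v) = 0 := by rw [hN]; simp
  have hz1 : (-N.1 + christoffelCLM γ₁ p.1 a.1 v.1) = 0 := by
    have := congrArg Prod.fst hz; rwa [prodChristoffel_apply] at this
  have hz2 : (-N.2 + christoffelCLM γ₂ p.2 a.2 v.2) = 0 := by
    have := congrArg Prod.snd hz; rwa [prodChristoffel_apply] at this
  simp only [zero_smul, add_zero, Prod.fst_neg, Prod.snd_neg, hz, hz1, hz2, Prod.fst_zero,
    Prod.snd_zero, map_zero, zero_apply, mul_zero, zero_add] at d1 d2 d3 d4 d5 i1 i2 j1 j2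
  have D := ((d1.mul i1).add (d2.mul i2)).add (((d3.mul ((j1 b).mul (j1 c))).add
    (d4.mul (((j1 b).mul (j2 c)).add ((j2 b).mul (j1 c))))).add
    (d5.mul ((j2 b).mul (j2 c))) |>.const_mul 2)
  have hU : ∀ᶠ r in nhds (0 : ℝ), p + r • a ∈ U₁ ×ˢ U₂ :=
    hc.continuousAt.eventually_mem (h.isOpen.mem_nhds hp0)
  have hne : ∀ᶠ r in nhds (0 : ℝ), v + r • (-N) ≠ 0 := hW.continuousAt.eventually_ne hv0
  have D' := D.congr_of_eventuallyEq
    (f₁ := fun r : ℝ => fundCoord L (p + r • a) (v + r • (-N)) b c) (by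
      filter_upwards [hU, hne] with r hr hr'
      exact h.fundCoord_apply hr hr' b c)
  have F1 : HasDerivAt (fun r : ℝ => fundCoord L (p + r • a) (v + r • (-N)))
      (horizontalDerivFund L p v a) 0 := by
    have hΨ' := hΨ.hasFDerivAt
    rw [show ((p, v) : (E₁ × E₂) × (E₁ × E₂)) =
      (fun r : ℝ => (p + r • a, v + r • (-N))) 0 by simp] at hΨ'
    have := hΨ'.comp_hasDerivAt (0 : ℝ) (hc.prodMk hW)
    simp only [zero_smul, add_zero, ← e3] at this
    exact this
  have F2 := (F1.clm_apply (hasDerivAt_const 0 b)).clm_apply (hasDerivAt_const 0 c)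
  simp only [map_zero, add_zero] at F2
  rw [F2.unique D']
  simp only [zero_smul, add_zero, zero_mul, zero_add, productForm, prodChristoffel_apply,
    Prod.fst_add, Prod.snd_add, Prod.smul_fst, Prod.smul_snd, Pi.mul_apply]
  rw [h.metric₁.symm _ hp.1 b.1, h.metric₂.symm _ hp.2 b.2]
  ring

/-- The horizontal derivative of `g` is metric for `Γ`, and `Γ` is symmetric, so the Koszul
combination returns `Γ`, as in the uniqueness of the Levi-Civita connection. -/
lemma chernCoord_eq (h : IsProductOn f γ₁ U₁ γ₂ U₂ L) (hf : ConvexityConditions f)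
    (hp : p ∈ U₁ ×ˢ U₂) (hv : v ≠ 0) (a b : E₁ × E₂) :
    chernCoord L p v a b = prodChristoffel γ₁ γ₂ p a b := by
  refine raise_eq (h.isInvertible_fundCoord hf hp hv) fun c => ?_
  rw [h.fundCoord_apply hp hv, koszul_apply]
  simp only [h.horizontalDerivFund_apply hf hp hv]
  rw [h.prodChristoffel_symm hp b a, h.prodChristoffel_symm hp c a, h.prodChristoffel_symm hp c b]
  ring

/-- The vertical Hessian of the quadratic spray is `Γ`, which is also the Chern connection. -/
lemma landsbergCoord_eq_zero (h : IsProductOn f γ₁ U₁ γ₂ U₂ L) (hf : ConvexityConditions f)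
    (hp : p ∈ U₁ ×ˢ U₂) (hv : v ≠ 0) (a b : E₁ × E₂) : landsbergCoord L p v a b = 0 := by
  have : fderiv ℝ (sprayCoord L p) =ᶠ[nhds v] prodChristoffel γ₁ γ₂ p := by
    filter_upwards [isOpen_ne.mem_nhds hv] with w hw
    exact h.fderiv_sprayCoord hf hp hw
  rw [landsbergCoord, h.chernCoord_eq hf hp hv, this.fderiv_eq,
    (prodChristoffel γ₁ γ₂ p).fderiv, sub_self]

/-- Each term of `g_v` with a second derivative of `f` contains the inner product of some `R(u_i,
v_i)v_i` with `v_i`, which is zero. -/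
lemma fundCoord_riemannCoord_self (h : IsProductOn f γ₁ U₁ γ₂ U₂ L) (hf : ConvexityConditions f)
    (hp : p ∈ U₁ ×ˢ U₂) (hv : v ≠ 0) (u : E₁ × E₂) :
    fundCoord L p v (riemannCoord L p v u) u =
      partialS f (normPair γ₁ γ₂ p v) *
          γ₁ p.1 (connectionCurvature (christoffelCLM γ₁) p.1 u.1 v.1) u.1 +
        partialT f (normPair γ₁ γ₂ p v) *
          γ₂ p.2 (connectionCurvature (christoffelCLM γ₂) p.2 u.2 v.2) u.2 := by
  rw [h.fundCoord_apply hp hv, h.riemannCoord_eq hf hp hv, productForm,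
    h.metric₁.symm _ hp.1 v.1 (connectionCurvature _ _ _ _),
    h.metric₂.symm _ hp.2 v.2 (connectionCurvature _ _ _ _),
    h.metric₁.apply_connectionCurvature hp.1, h.metric₂.apply_connectionCurvature hp.2]
  ring

end IsProductOn

end ProductCoordinates

/-! ### Linear isometries between inner products -/

section Isometry

/-- The space `V` carries no norm, so `B` itself can be installed as the inner product and the
normalised `v` extended to an orthonormal basis. If `v = 0` the initial vector is any unit vector;
quantifying over `i` with `i.val = 0` also covers dimension zero. -/
lemma exists_orthonormal_basis_of_form {V : Type*} [AddCommGroup V] [Module ℝ V]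
    [FiniteDimensional ℝ V] (B : V →ₗ[ℝ] V →ₗ[ℝ] ℝ) (hsymm : ∀ v w, B v w = B w v)
    (hpos : ∀ v, v ≠ 0 → 0 < B v v) (v : V) :
    ∃ b : Module.Basis (Fin (Module.finrank ℝ V)) ℝ V,
      (∀ i j, B (b i) (b j) = if i = j then 1 else 0) ∧
      ∀ i, i.val = 0 → v = Real.sqrt (B v v) • b i := by
  have hnn : ∀ v, 0 ≤ B v v := fun v => by
    by_cases h : v = 0
    · simp [h]
    · exact (hpos v h).le
  let core : InnerProductSpace.Core ℝ V :=
    { inner := fun x y => B x y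
      conj_inner_symm := fun x y => by simpa using hsymm y x
      re_inner_nonneg := fun x => hnn x
      add_left := fun x y z => by simp
      smul_left := fun x y r => by simp
      definite := fun x hx => by
        by_contra h
        exact (hpos x h).ne' hx }
  let _ : NormedAddCommGroup V := core.toNormedAddCommGroup
  let _ : InnerProductSpace ℝ V := InnerProductSpace.ofCore core.toCore
  have hinner : ∀ x y : V, inner ℝ x y = B x y := fun x y => rfl
  rcases Nat.eq_zero_or_pos (Module.finrank ℝ V) with h0 | h0
  · refine ⟨Module.finBasis ℝ V, fun i => ?_, fun i => ?_⟩ <;>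
    exact absurd i.2 (by omega)
  obtain ⟨e, he, hve⟩ : ∃ e : V, B e e = 1 ∧ v = Real.sqrt (B v v) • e := by
    have key : ∀ w : V, w ≠ 0 → B ((Real.sqrt (B w w))⁻¹ • w) ((Real.sqrt (B w w))⁻¹ • w) = 1 := by
      intro w hw
      have h1 := hpos w hw
      have h2 := Real.mul_self_sqrt h1.le
      have h3 := (Real.sqrt_pos.2 h1).ne'
      simp only [map_smul, LinearMap.smul_apply, smul_eq_mul]
      field_simp
      rw [sq, h2]
    by_cases hv : v = 0
    · have : Nontrivial V := Module.nontrivial_of_finrank_pos h0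
      obtain ⟨w, hw⟩ := exists_ne (0 : V)
      exact ⟨_, key w hw, by simp [hv]⟩
    · refine ⟨_, key v hv, ?_⟩
      rw [smul_smul, mul_inv_cancel₀ (Real.sqrt_pos.2 (hpos v hv)).ne', one_smul]
  have horth : Orthonormal ℝ (({(⟨0, h0⟩ : Fin (Module.finrank ℝ V))} : Set _).domRestrict
      fun _ : Fin (Module.finrank ℝ V) => e) := by
    rw [orthonormal_iff_ite]
    intro i j
    rw [if_pos (Subsingleton.elim i j)]
    exact he
  obtain ⟨b, hb⟩ := horth.exists_orthonormalBasis_extension_of_card_eq (by simp)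
  refine ⟨b.toBasis, fun i j => ?_, fun i hi => ?_⟩
  · have := orthonormal_iff_ite.1 b.orthonormal i j
    simpa [hinner] using this
  · have h1 : i = ⟨0, h0⟩ := Fin.ext hi
    rw [OrthonormalBasis.coe_toBasis, hb i (by simp [h1])]
    exact hve

variable {E : Type*} [NormedAddCommGroup E] [NormedSpace ℝ E] [FiniteDimensional ℝ E]

/-- Two vectors of the same length correspond under an isometry of the inner products. -/
lemma exists_isometry {B B' : E →L[ℝ] E →L[ℝ] ℝ} (hs : ∀ v w, B v w = B w v)
    (hp : ∀ v, v ≠ 0 → 0 < B v v) (hs' : ∀ v w, B' v w = B' w v)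
    (hp' : ∀ v, v ≠ 0 → 0 < B' v v) {v v' : E} (hv : B v v = B' v' v') :
    ∃ A : E ≃L[ℝ] E, A v = v' ∧ ∀ w, B' (A w) (A w) = B w w := by
  have key := fun (B : E →L[ℝ] E →L[ℝ] ℝ) (hs : ∀ v w, B v w = B w v)
    (hp : ∀ v, v ≠ 0 → 0 < B v v) (v : E) =>
    exists_orthonormal_basis_of_form (ContinuousLinearMap.coeLM ℝ ∘ₗ B.toLinearMap) hs hp v
  obtain ⟨b, hb, hbv⟩ := key B hs hp v
  obtain ⟨b', hb', hbv'⟩ := key B' hs' hp' v'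
  have hb1 : ∀ i j, B (b i) (b j) = if i = j then 1 else 0 := hb
  have hb1' : ∀ i j, B' (b' i) (b' j) = if i = j then 1 else 0 := hb'
  have hbv1 : ∀ i, i.val = 0 → v = Real.sqrt (B v v) • b i := hbv
  have hbv1' : ∀ i, i.val = 0 → v' = Real.sqrt (B' v' v') • b' i := hbv'
  -- Adapted orthonormal bases are matched; `v` and `v'` have the same coefficient on the initial
  -- vectors.
  refine ⟨(b.equiv b' (Equiv.refl _)).toContinuousLinearEquiv, ?_, fun w => ?_⟩
  · rcases Nat.eq_zero_or_pos (Module.finrank ℝ E) with h0 | h0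
    · have := Module.finrank_zero_iff.1 h0
      exact Subsingleton.elim _ _
    · rw [hbv1 ⟨0, h0⟩ rfl, hbv1' ⟨0, h0⟩ rfl, ← hv]
      simp
  · have hw := b.sum_repr w
    rw [← hw]
    simp only [map_sum, map_smul, LinearEquiv.coe_toContinuousLinearEquiv', Module.Basis.equiv_apply,
      Equiv.refl_apply, sum_apply, smul_apply, hb1, hb1']

end Isometry

/-! ### Invariance of the distortion under linear changes of coordinates -/

section Distortion

variable {E : Type*} [NormedAddCommGroup E] [NormedSpace ℝ E]

/-- The factor `k` serves two uses: `k = 1` for linear maps preserving `F`, and `k = r⁻²` for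
scaling by `r`. -/
lemma fundCoord_comp_equiv {L : E → E → ℝ} {p p' : E} {k : ℝ} (A : E ≃L[ℝ] E)
    (hL : ∀ w, L p w ^ 2 = k * L p' (A w) ^ 2) (v a b : E) :
    fundCoord L p v a b = k * fundCoord L p' (A v) (A a) (A b) := by
  set h' := fun w => L p' w ^ 2 with hh'
  have h0 : (fun w => L p w ^ 2) = k • (h' ∘ A) := funext fun w => by simp [hL, hh']
  have h1 : fderiv ℝ (fun w => L p w ^ 2) =
      k • ((A.symm.arrowCongr (ContinuousLinearEquiv.refl ℝ ℝ)) ∘ (fderiv ℝ h' ∘ A)) := by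
    rw [h0]
    ext w u
    rw [fderiv_const_smul_field, Pi.smul_apply, Pi.smul_apply, Function.comp_apply,
      Function.comp_apply, A.comp_right_fderiv]
    simp
  rw [fundCoord, fundCoord, h1, fderiv_const_smul_field, Pi.smul_apply, ContinuousLinearEquiv.comp_fderiv,
    A.comp_right_fderiv]
  simp only [smul_apply, ContinuousLinearMap.comp_apply, smul_eq_mul]
  simp
  ring

variable [FiniteDimensional ℝ E]

lemma det_fundCoord_comp_equiv {L : E → E → ℝ} {p p' : E} (A : E ≃L[ℝ] E)
    (hL : ∀ w, L p w = L p' (A w)) (v : E) :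
    Matrix.det (Matrix.of fun i j =>
      fundCoord L p v (Module.finBasis ℝ E i) (Module.finBasis ℝ E j)) =
    LinearMap.det (A : E →ₗ[ℝ] E) ^ 2 * Matrix.det (Matrix.of fun i j =>
      fundCoord L p' (A v) (Module.finBasis ℝ E i) (Module.finBasis ℝ E j)) := by
  set e := Module.finBasis ℝ E with he
  let B : E →ₗ[ℝ] E →ₗ[ℝ] ℝ := ContinuousLinearMap.coeLM ℝ ∘ₗ (fundCoord L p' (A v)).toLinearMap
  have h1 : (Matrix.of fun i j => fundCoord L p v (e i) (e j)) =
      LinearMap.toMatrix₂ e e (B.compl₁₂ (A : E →ₗ[ℝ] E) (A : E →ₗ[ℝ] E)) := by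
    ext i j
    rw [LinearMap.toMatrix₂_apply, Matrix.of_apply,
      fundCoord_comp_equiv A (k := 1) (fun w => by rw [hL, one_mul]), one_mul]
    rfl
  have h2 : (Matrix.of fun i j => fundCoord L p' (A v) (e i) (e j)) =
      LinearMap.toMatrix₂ e e B := by
    ext i j
    rw [LinearMap.toMatrix₂_apply, Matrix.of_apply]
    rfl
  rw [h1, h2, LinearMap.toMatrix₂_compl₁₂ e e, Matrix.det_mul, Matrix.det_mul,
    Matrix.det_transpose, LinearMap.det_toMatrix]
  ring

/-- The unit ball at `p` is the preimage under `A` of that at `p'`, so its volume scales by `|det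
A|⁻¹`, and the volume stands in the denominator. The factor is the one by which `√(det g)` changes,
so the distortion is invariant. -/
lemma volumeDensityCoord_comp_equiv {L : E → E → ℝ} {p p' : E} (A : E ≃L[ℝ] E)
    (hL : ∀ w, L p w = L p' (A w)) :
    volumeDensityCoord L p = |LinearMap.det (A : E →ₗ[ℝ] E)| * volumeDensityCoord L p' := by
  set e := Module.finBasis ℝ E with he
  let A' : (Fin (Module.finrank ℝ E) → ℝ) →ₗ[ℝ] (Fin (Module.finrank ℝ E) → ℝ) :=
    (e.equivFun : E →ₗ[ℝ] _) ∘ₗ (A : E →ₗ[ℝ] E) ∘ₗ (e.equivFun.symm : _ →ₗ[ℝ] E)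
  have hdet : LinearMap.det A' = LinearMap.det (A : E →ₗ[ℝ] E) := LinearMap.det_conj _ _
  have hd0 : LinearMap.det (A : E →ₗ[ℝ] E) ≠ 0 := (LinearEquiv.isUnit_det' A.toLinearEquiv).ne_zero
  have hset : {c : Fin (Module.finrank ℝ E) → ℝ | L p (∑ i, c i • e i) < 1} =
      A' ⁻¹' {c | L p' (∑ i, c i • e i) < 1} := by
    ext c
    simp only [Set.mem_ofPred_eq, Set.mem_preimage, ← Module.Basis.equivFun_symm_apply, hL]
    simp [A']
  rw [volumeDensityCoord, volumeDensityCoord, ← he, hset,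
    MeasureTheory.Measure.addHaar_preimage_linearMap _ (hdet ▸ hd0), hdet, ENNReal.toReal_mul,
    ENNReal.toReal_ofReal (abs_nonneg _), abs_inv]
  have := abs_ne_zero.2 hd0
  rw [div_mul_eq_div_div, div_inv_eq_mul, mul_comm _ |_|, mul_div_assoc]

lemma distortionCoord_comp_equiv {L : E → E → ℝ} {p p' : E} (A : E ≃L[ℝ] E)
    (hL : ∀ w, L p w = L p' (A w)) (v : E) :
    distortionCoord L p v = distortionCoord L p' (A v) := by
  have hd0 : LinearMap.det (A : E →ₗ[ℝ] E) ≠ 0 := (LinearEquiv.isUnit_det' A.toLinearEquiv).ne_zero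
  rw [distortionCoord, distortionCoord, det_fundCoord_comp_equiv A hL,
    volumeDensityCoord_comp_equiv A hL, Real.sqrt_mul (sq_nonneg _), Real.sqrt_sq_eq_abs,
    mul_div_mul_left _ _ (abs_ne_zero.2 hd0)]

/-- The distortion is positively homogeneous of degree zero. -/
lemma distortionCoord_smul {L : E → E → ℝ} {p : E} {r : ℝ} (hr : 0 < r)
    (hL : ∀ w, L p (r • w) = r * L p w) (v : E) :
    distortionCoord L p (r • v) = distortionCoord L p v := by
  have h : fundCoord L p v = fundCoord L p (r • v) := by
    ext a b
    have := fundCoord_comp_equiv (L := L) (p := p) (p' := p) (k := (r ^ 2)⁻¹)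
      (ContinuousLinearEquiv.smulLeft (Units.mk0 r hr.ne')) (fun w => by
        simp only [ContinuousLinearEquiv.smulLeft_apply_apply, Units.smul_mk0, hL]
        field_simp) v a b
    rw [this]
    simp only [ContinuousLinearEquiv.smulLeft_apply_apply, Units.smul_mk0, map_smul, smul_apply,
      smul_eq_mul]
    field_simp
  rw [distortionCoord, distortionCoord, h]

end Distortion

/-! ### Curves of constant length with parallel initial velocity -/

section Curve

variable {E : Type*} [NormedAddCommGroup E] [NormedSpace ℝ E] [FiniteDimensional ℝ E]
  {γ : E → E →L[ℝ] E →L[ℝ] ℝ} {U : Set E} {p : E}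

/-- A curve of tangent vectors of constant length which is parallel at the initial time. -/
lemma IsMetricOn.exists_curve (hγ : IsMetricOn γ U) (hp : p ∈ U) (a v : E) :
    ∃ W : ℝ → E, W 0 = v ∧ HasDerivAt W (-christoffelCLM γ p a v) 0 ∧
      ∀ᶠ r in nhds (0 : ℝ), γ (p + r • a) (W r) (W r) = γ p v v := by
  by_cases hv : v = 0
  · refine ⟨fun _ => 0, hv.symm, ?_, ?_⟩
    · simpa [hv] using hasDerivAt_const (0 : ℝ) (0 : E)
    · simp [hv]
  have hpos := hγ.pos p hp v hv
  have hp0 : p + (0 : ℝ) • a ∈ U := by simpa using hp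
  -- The affine curve has the right velocity and squared length stationary at `0`. Rescaling it to
  -- constant length uses a factor with value `1` and derivative `0` there, so the velocity is
  -- unchanged.
  set w : ℝ → E := fun r => v + r • (-christoffelCLM γ p a v) with hw
  have hw' : HasDerivAt w (-christoffelCLM γ p a v) 0 := hasDerivAt_line _ _
  have hw0 : w 0 = v := by simp [hw]
  have hn := hγ.hasDerivAt_apply hp0 (hasDerivAt_line p a) hw' hw'
  simp only [hw0, zero_smul, add_zero, neg_add_cancel, map_zero, zero_apply] at hn
  set n : ℝ → ℝ := fun r => γ (p + r • a) (w r) (w r) with hn_def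
  have hn0 : n 0 = γ p v v := by simp [hn_def, hw0]
  have hρ : HasDerivAt (fun r => Real.sqrt (γ p v v / n r)) 0 0 := by
    have h1 := ((hasDerivAt_const (0 : ℝ) (γ p v v)).div hn (by rw [hn0]; exact hpos.ne')).sqrt
      (by simp [hn0, div_self hpos.ne'])
    simpa using h1
  refine ⟨fun r => Real.sqrt (γ p v v / n r) • w r, ?_, ?_, ?_⟩
  · simp [hn0, hw0, div_self hpos.ne']
  · have := hρ.smul hw'
    simp only [hn0, div_self hpos.ne', Real.sqrt_one, one_smul, zero_smul, add_zero] at this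
    exact this
  · have : ∀ᶠ r in nhds (0 : ℝ), 0 < n r :=
      hn.continuousAt.eventually (lt_mem_nhds (by rw [hn0]; exact hpos))
    filter_upwards [this] with r hr
    simp only [map_smul, smul_apply, smul_eq_mul]
    rw [← mul_assoc, Real.mul_self_sqrt (by positivity)]
    exact div_mul_cancel₀ _ hr.ne'

end Curve

/-! ### Distortion, S-curvature and mean Cartan torsion of the product -/

section ProductCoordinates

variable {E₁ : Type*} [NormedAddCommGroup E₁] [NormedSpace ℝ E₁] [FiniteDimensional ℝ E₁]
  {E₂ : Type*} [NormedAddCommGroup E₂] [NormedSpace ℝ E₂] [FiniteDimensional ℝ E₂]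

variable {f : ℝ × ℝ → ℝ} {γ₁ : E₁ → E₁ →L[ℝ] E₁ →L[ℝ] ℝ} {U₁ : Set E₁}
  {γ₂ : E₂ → E₂ →L[ℝ] E₂ →L[ℝ] ℝ} {U₂ : Set E₂} {L : E₁ × E₂ → E₁ × E₂ → ℝ} {p v : E₁ × E₂}

namespace IsProductOn

/-- The distortion is a function of the lengths of the two components. -/
lemma distortionCoord_congr (h : IsProductOn f γ₁ U₁ γ₂ U₂ L) {p p' v v' : E₁ × E₂}
    (hp : p ∈ U₁ ×ˢ U₂) (hp' : p' ∈ U₁ ×ˢ U₂)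
    (hv : normPair γ₁ γ₂ p v = normPair γ₁ γ₂ p' v') :
    distortionCoord L p v = distortionCoord L p' v' := by
  obtain ⟨hv1, hv2⟩ := Prod.ext_iff.1 hv
  obtain ⟨A₁, hA₁, hi₁⟩ := exists_isometry (h.metric₁.symm _ hp.1) (h.metric₁.pos _ hp.1)
    (h.metric₁.symm _ hp'.1) (h.metric₁.pos _ hp'.1) hv1
  obtain ⟨A₂, hA₂, hi₂⟩ := exists_isometry (h.metric₂.symm _ hp.2) (h.metric₂.pos _ hp.2)
    (h.metric₂.symm _ hp'.2) (h.metric₂.pos _ hp'.2) hv2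
  have hA : ∀ w, A₁.prodCongr A₂ w = (A₁ w.1, A₂ w.2) := fun w => rfl
  rw [distortionCoord_comp_equiv (p' := p') (A₁.prodCongr A₂), hA, hA₁, hA₂]
  intro w
  rw [h.eq_sqrt p hp, h.eq_sqrt p' hp', hA]
  simp only [normPair, hi₁, hi₂]

/-- The geodesic-flow velocity `(v, -Γ(v, v))` is also the velocity of a curve along which both
lengths are constant, and the distortion depends on nothing else. -/
lemma sCurvatureCoord_eq_zero (h : IsProductOn f γ₁ U₁ γ₂ U₂ L) (hf : ConvexityConditions f)
    (hp : p ∈ U₁ ×ˢ U₂) (hv : v ≠ 0) : sCurvatureCoord L p v = 0 := by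
  rw [sCurvatureCoord]
  -- Without differentiability `fderiv` is zero by convention, so smoothness of the distortion need
  -- not be established.
  by_cases hd : DifferentiableAt ℝ
      (fun z : (E₁ × E₂) × (E₁ × E₂) => distortionCoord L z.1 z.2) (p, v)
  swap
  · rw [fderiv_zero_of_not_differentiableAt hd, zero_apply]
  obtain ⟨W₁, hW₁, hd₁, hn₁⟩ := h.metric₁.exists_curve hp.1 v.1 v.1
  obtain ⟨W₂, hW₂, hd₂, hn₂⟩ := h.metric₂.exists_curve hp.2 v.2 v.2
  have hc := hasDerivAt_line p v
  have h1 : HasDerivAt (fun r : ℝ => (p + r • v, (W₁ r, W₂ r)))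
      (v, -(2 : ℝ) • sprayCoord L p v) 0 := by
    refine (hc.prodMk (hd₁.prodMk hd₂)).congr_deriv ?_
    rw [h.sprayCoord_eq hf hp hv, smul_smul, prodChristoffel_apply]
    norm_num
  have hd' := hd.hasFDerivAt
  rw [show (p, v) = (fun r : ℝ => (p + r • v, (W₁ r, W₂ r))) 0 by simp [hW₁, hW₂]] at hd'
  have h2 := hd'.comp_hasDerivAt (0 : ℝ) h1
  simp only [zero_smul, add_zero, hW₁, hW₂, Prod.mk.eta] at h2
  have hU : ∀ᶠ r in nhds (0 : ℝ), p + r • v ∈ U₁ ×ˢ U₂ :=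
    hc.continuousAt.eventually_mem (h.isOpen.mem_nhds (by simpa using hp))
  have h3 : HasDerivAt ((fun z : (E₁ × E₂) × (E₁ × E₂) => distortionCoord L z.1 z.2) ∘
      fun r : ℝ => (p + r • v, (W₁ r, W₂ r))) 0 0 := by
    refine (hasDerivAt_const (0 : ℝ) (distortionCoord L p v)).congr_of_eventuallyEq ?_
    filter_upwards [hU, hn₁, hn₂] with r hr hr₁ hr₂
    exact h.distortionCoord_congr hr hp (Prod.ext hr₁ hr₂)
  exact h2.unique h3

/-- The mean Cartan tensor annihilates the vectors orthogonal to both components. -/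
lemma meanCartanCoord_eq_zero (h : IsProductOn f γ₁ U₁ γ₂ U₂ L) (hp : p ∈ U₁ ×ˢ U₂)
    {b : E₁ × E₂} (hb₁ : γ₁ p.1 v.1 b.1 = 0) (hb₂ : γ₂ p.2 v.2 b.2 = 0) :
    meanCartanCoord L p v b = 0 := by
  rw [meanCartanCoord]
  by_cases hd : DifferentiableAt ℝ (distortionCoord L p) v
  swap
  · rw [fderiv_zero_of_not_differentiableAt hd, zero_apply]
  have h1 : HasDerivAt (fun r : ℝ => distortionCoord L p (v + r • b)) _ 0 :=
    hd.hasFDerivAt.hasLineDerivAt b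
  have h2 : HasDerivAt (fun r : ℝ => distortionCoord L p (v + r • (-b))) _ 0 :=
    hd.hasFDerivAt.hasLineDerivAt (-b)
  -- The vectors `v + r b` and `v - r b` have equal lengths in each factor, so the derivative in the
  -- direction `b` equals its own negative.
  have h3 : (fun r : ℝ => distortionCoord L p (v + r • (-b))) =
      fun r : ℝ => distortionCoord L p (v + r • b) := by
    ext r
    refine h.distortionCoord_congr hp hp (Prod.ext ?_ ?_)
    · simp [normPair, hb₁, h.metric₁.symm _ hp.1 b.1 v.1]
    · simp [normPair, hb₂, h.metric₂.symm _ hp.2 b.2 v.2]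
  rw [h3] at h2
  have h4 := h2.unique h1
  rw [map_neg] at h4
  linarith

/-- Euler's relation for a function homogeneous of degree zero. -/
lemma meanCartanCoord_self (h : IsProductOn f γ₁ U₁ γ₂ U₂ L) (hp : p ∈ U₁ ×ˢ U₂) :
    meanCartanCoord L p v v = 0 := by
  rw [meanCartanCoord]
  by_cases hd : DifferentiableAt ℝ (distortionCoord L p) v
  swap
  · rw [fderiv_zero_of_not_differentiableAt hd, zero_apply]
  have h1 : HasDerivAt (fun r : ℝ => distortionCoord L p (v + r • v)) _ 0 :=
    hd.hasFDerivAt.hasLineDerivAt v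
  have h2 : HasDerivAt (fun r : ℝ => distortionCoord L p (v + r • v)) 0 0 := by
    refine (hasDerivAt_const (0 : ℝ) (distortionCoord L p v)).congr_of_eventuallyEq ?_
    filter_upwards [lt_mem_nhds (show (-1 : ℝ) < 0 by norm_num)] with r hr
    rw [show v + r • v = (1 + r) • v by rw [add_smul, one_smul]]
    exact distortionCoord_smul (by linarith) (h.apply_smul hp (by linarith)) v
  exact h1.unique h2

lemma meanLandsbergCoord_eq_zero (h : IsProductOn f γ₁ U₁ γ₂ U₂ L) (hf : ConvexityConditions f)
    (hp : p ∈ U₁ ×ˢ U₂) (hv : v ≠ 0) (u : E₁ × E₂) : meanLandsbergCoord L p v u = 0 := by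
  simp only [meanLandsbergCoord, h.landsbergCoord_eq_zero hf hp hv, map_zero,
    Finset.sum_const_zero]

/-- The components of the mean Cartan torsion vector are multiples of the components of `v`. -/
lemma raise_meanCartanCoord (h : IsProductOn f γ₁ U₁ γ₂ U₂ L) (hf : ConvexityConditions f)
    (hp : p ∈ U₁ ×ˢ U₂) (hv : v ≠ 0) :
    ∃ c₁ c₂ : ℝ, raise (fundCoord L p v) (meanCartanCoord L p v) = (c₁ • v.1, c₂ • v.2) := by
  set u := raise (fundCoord L p v) (meanCartanCoord L p v) with hu
  have hg : ∀ w, productForm f γ₁ γ₂ p v u w = meanCartanCoord L p v w := fun w => by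
    rw [← h.fundCoord_apply hp hv, hu, apply_raise (h.isInvertible_fundCoord hf hp hv)]
  obtain ⟨c1, c2, -⟩ := hf _ (h.normPair_mem hp v) (h.normPair_ne_zero hp hv)
  refine ⟨γ₁ p.1 v.1 u.1 / γ₁ p.1 v.1 v.1, γ₂ p.2 v.2 u.2 / γ₂ p.2 v.2 v.2, Prod.ext ?_ ?_⟩
  -- Let `w` be the part of `u.1` orthogonal to `v.1`. The mean Cartan tensor kills `(w, 0)`, while
  -- `g_v(u, (w, 0))` reduces to `f_s γ₁(u.1, w)`; hence `γ₁(w, w) = 0`. If `v.1 = 0` the quotient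
  -- `c` is zero by convention and the argument gives `u.1 = 0`.
  · set c := γ₁ p.1 v.1 u.1 / γ₁ p.1 v.1 v.1 with hc
    have h1 : γ₁ p.1 v.1 (u.1 - c • v.1) = 0 := by
      by_cases hv1 : v.1 = 0
      · simp [hv1]
      · have := (h.metric₁.pos _ hp.1 _ hv1).ne'
        simp [hc, div_mul_cancel₀ _ this]
    have h2 := hg (u.1 - c • v.1, 0)
    rw [h.meanCartanCoord_eq_zero hp h1 (by simp)] at h2
    simp only [productForm, h1, map_zero, mul_zero, add_zero, mul_eq_zero, c1.ne', false_or] at h2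
    rw [← sub_eq_zero]
    refine h.metric₁.eq_zero hp.1 ?_
    change γ₁ p.1 (u.1 - c • v.1) (u.1 - c • v.1) = 0
    rw [(γ₁ p.1).map_sub, sub_apply, h2, (γ₁ p.1).map_smul, smul_apply, h1, smul_zero,
      sub_zero]
  · set c := γ₂ p.2 v.2 u.2 / γ₂ p.2 v.2 v.2 with hc
    have h1 : γ₂ p.2 v.2 (u.2 - c • v.2) = 0 := by
      by_cases hv2 : v.2 = 0
      · simp [hv2]
      · have := (h.metric₂.pos _ hp.2 _ hv2).ne'
        simp [hc, div_mul_cancel₀ _ this]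
    have h2 := hg (0, u.2 - c • v.2)
    rw [h.meanCartanCoord_eq_zero hp (by simp) h1] at h2
    simp only [productForm, h1, map_zero, mul_zero, add_zero, zero_add, mul_eq_zero, c2.ne',
      false_or] at h2
    rw [← sub_eq_zero]
    refine h.metric₂.eq_zero hp.2 ?_
    change γ₂ p.2 (u.2 - c • v.2) (u.2 - c • v.2) = 0
    rw [(γ₂ p.2).map_sub, sub_apply, h2, (γ₂ p.2).map_smul, smul_apply, h1, smul_zero,
      sub_zero]

/-- In each factor the component of the torsion vector is a multiple `c v_i`, and `R(c v_i, v_i)v_i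
= 0`. This needs no curvature assumption. -/
lemma riemannCoord_meanCartan (h : IsProductOn f γ₁ U₁ γ₂ U₂ L) (hf : ConvexityConditions f)
    (hp : p ∈ U₁ ×ˢ U₂) (hv : v ≠ 0) :
    riemannCoord L p v (raise (fundCoord L p v) (meanCartanCoord L p v)) = 0 := by
  obtain ⟨c₁, c₂, hc⟩ := h.raise_meanCartanCoord hf hp hv
  rw [h.riemannCoord_eq hf hp hv, hc]
  simp only [connectionCurvature_self]
  rfl

/-- Raising the index gives `g_v(I, v) = I(v) = 0`, while `g_v(v, v) > 0`, so a nonzero `I` is not a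
multiple of `v`. -/
lemma linearIndependent_meanCartan (h : IsProductOn f γ₁ U₁ γ₂ U₂ L)
    (hf : ConvexityConditions f) (hp : p ∈ U₁ ×ˢ U₂) (hv : v ≠ 0)
    (hI : raise (fundCoord L p v) (meanCartanCoord L p v) ≠ 0) :
    LinearIndependent ℝ ![v, raise (fundCoord L p v) (meanCartanCoord L p v)] := by
  rw [LinearIndependent.pair_iff' hv]
  intro c hc
  have h1 := apply_raise (h.isInvertible_fundCoord hf hp hv) (meanCartanCoord L p v) v
  rw [h.meanCartanCoord_self hp, ← hc, map_smul, smul_apply, h.fundCoord_apply hp hv,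
    smul_eq_mul, mul_eq_zero] at h1
  rcases h1 with h1 | h1
  · exact hI (by rw [← hc, h1, zero_smul])
  · exact (h.productForm_self_pos hf hp hv hv).ne' h1

end IsProductOn

end ProductCoordinates

/-! ### Riemannian metrics in charts -/

section Charts

variable {E : Type*} [NormedAddCommGroup E] [NormedSpace ℝ E]

lemma contMDiffOn_inner {H : Type*} [TopologicalSpace H] {I : ModelWithCorners ℝ E H} {M : Type*}
    [TopologicalSpace M] [ChartedSpace H M] [IsManifold I ∞ M]
    (g : Bundle.ContMDiffRiemannianMetric I ∞ E (fun x : M => TangentSpace I x))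
    {E' H' N : Type*} [NormedAddCommGroup E'] [NormedSpace ℝ E'] [TopologicalSpace H']
    {J : ModelWithCorners ℝ E' H'} [TopologicalSpace N] [ChartedSpace H' N] {s : Set N}
    {b : N → M} {v w : ∀ z, TangentSpace I (b z)}
    (hv : ContMDiffOn J I.tangent ∞ (fun z => (⟨b z, v z⟩ : TangentBundle I M)) s)
    (hw : ContMDiffOn J I.tangent ∞ (fun z => (⟨b z, w z⟩ : TangentBundle I M)) s) :
    ContMDiffOn J 𝓘(ℝ, ℝ) ∞ (fun z => g.inner (b z) (v z) (w z)) s := by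
  intro z hz
  have hb : ContMDiffWithinAt J I ∞ b s z :=
    (Bundle.contMDiffWithinAt_totalSpace.1 (hv z hz)).1
  have : ContMDiffWithinAt J (I.prod 𝓘(ℝ)) ∞
      (fun m => Bundle.TotalSpace.mk' ℝ (E := Bundle.Trivial M ℝ) (b m)
        (g.inner (b m) (v m) (w m))) s z := by
    apply ContMDiffWithinAt.clm_bundle_apply₂ (F₁ := E) (F₂ := E)
    · exact ContMDiffAt.comp_contMDiffWithinAt z g.contMDiff.contMDiffAt hb
    · exact hv z hz
    · exact hw z hz
  simp only [Bundle.contMDiffWithinAt_totalSpace] at this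
  exact this.2

variable {M : Type*} [TopologicalSpace M] [ChartedSpace E M] [IsManifold 𝓘(ℝ, E) ∞ M]

lemma mdifferentiableAt_chart_symm (c : M) {p : E} (hp : p ∈ (extChartAt 𝓘(ℝ, E) c).target) :
    MDifferentiableAt 𝓘(ℝ, E) 𝓘(ℝ, E) (extChartAt 𝓘(ℝ, E) c).symm p :=
  ((contMDiffOn_extChartAt_symm (n := ∞) c).contMDiffAt
    ((isOpen_extChartAt_target c).mem_nhds hp)).mdifferentiableAt (by simp)

lemma injective_mfderiv_chart_symm (c : M) {p : E} (hp : p ∈ (extChartAt 𝓘(ℝ, E) c).target) :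
    Function.Injective (mfderiv 𝓘(ℝ, E) 𝓘(ℝ, E) (extChartAt 𝓘(ℝ, E) c).symm p) := by
  have h := isInvertible_mfderivWithin_extChartAt_symm (I := 𝓘(ℝ, E)) hp
  simp only [modelWithCornersSelf_coe, Set.range_id, mfderivWithin_univ] at h
  exact h.injective

/-- Coordinate vector fields are smooth sections of the tangent bundle, so pairing them with `g`
yields smooth metric coefficients. -/
lemma contMDiffOn_mfderiv_chart_symm (c : M) (u : E) :
    ContMDiffOn 𝓘(ℝ, E) 𝓘(ℝ, E).tangent ∞
      (fun p : E => (⟨(extChartAt 𝓘(ℝ, E) c).symm p,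
        mfderiv 𝓘(ℝ, E) 𝓘(ℝ, E) (extChartAt 𝓘(ℝ, E) c).symm p u⟩ : TangentBundle 𝓘(ℝ, E) M))
      (extChartAt 𝓘(ℝ, E) c).target := by
  have hopen := isOpen_extChartAt_target (I := 𝓘(ℝ, E)) c
  have h1 := (contMDiffOn_extChartAt_symm (I := 𝓘(ℝ, E)) (n := ∞) c).contMDiffOn_tangentMapWithin
    (m := ∞) (by simp) hopen.uniqueMDiffOn
  have h2 : ContMDiff 𝓘(ℝ, E) 𝓘(ℝ, E).tangent ∞
      (fun p : E => (⟨p, u⟩ : TangentBundle 𝓘(ℝ, E) E)) := by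
    intro p
    rw [← contMDiffWithinAt_univ]
    exact contMDiffWithinAt_vectorSpace_iff_contDiffWithinAt.2 contDiffWithinAt_const
  refine (h1.comp (t := Bundle.TotalSpace.proj ⁻¹' (extChartAt 𝓘(ℝ, E) c).target)
    (s := (extChartAt 𝓘(ℝ, E) c).target) h2.contMDiffOn (fun p hp => hp)).congr ?_
  intro p hp
  simp only [Function.comp, tangentMapWithin, mfderivWithin_of_isOpen hopen hp]

variable (g : Bundle.ContMDiffRiemannianMetric 𝓘(ℝ, E) ∞ E
  (fun x : M => TangentSpace 𝓘(ℝ, E) x))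

lemma metricInChart_apply (c : M) (p u w : E) : metricInChart g c p u w =
    g.inner ((extChartAt 𝓘(ℝ, E) c).symm p)
      (mfderiv 𝓘(ℝ, E) 𝓘(ℝ, E) (extChartAt 𝓘(ℝ, E) c).symm p u)
      (mfderiv 𝓘(ℝ, E) 𝓘(ℝ, E) (extChartAt 𝓘(ℝ, E) c).symm p w) := rfl

lemma contDiffOn_metricInChart_apply (c : M) (u w : E) :
    ContDiffOn ℝ ∞ (fun p => metricInChart g c p u w) (extChartAt 𝓘(ℝ, E) c).target := by
  have h := contMDiffOn_iff_contDiffOn.1 (contMDiffOn_inner g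
    (contMDiffOn_mfderiv_chart_symm c u) (contMDiffOn_mfderiv_chart_symm c w))
  simp only [metricInChart_apply]
  exact h

lemma isMetricOn_metricInChart [FiniteDimensional ℝ E] (c : M) :
    IsMetricOn (metricInChart g c) (extChartAt 𝓘(ℝ, E) c).target where
  isOpen := isOpen_extChartAt_target c
  smooth := contDiffOn_clm_apply.2 fun u => contDiffOn_clm_apply.2 fun w =>
    contDiffOn_metricInChart_apply g c u w
  symm p _ v w := by
    rw [metricInChart_apply, metricInChart_apply]
    exact g.symm _ _ _
  pos p hp v hv := by
    rw [metricInChart_apply]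
    exact g.pos _ _ fun h0 => hv (injective_mfderiv_chart_symm c hp
      (h0.trans (ContinuousLinearMap.map_zero _).symm))

/-- At its own centre the inverse of the preferred chart has the identity as derivative, so the
coordinate metric there is `g` itself. -/
lemma metricInChart_self (x : M) (a b : E) :
    metricInChart g x (extChartAt 𝓘(ℝ, E) x x) a b = g.inner x a b := by
  have h1 := mfderivWithin_range_extChartAt_symm (I := 𝓘(ℝ, E)) (x := x)
  simp only [modelWithCornersSelf_coe, Set.range_id, mfderivWithin_univ] at h1
  -- Returning from the chart gives `x` only up to a propositional equality; stating this for
  -- general `z` allows the dependent tangent space to be transported.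
  have h2 : ∀ z : M, z = x → (g.inner z : E →L[ℝ] E →L[ℝ] ℝ) a b = g.inner x a b := by
    rintro _ rfl; rfl
  have h3 : metricInChart g x (extChartAt 𝓘(ℝ, E) x x) a b =
      (g.inner ((extChartAt 𝓘(ℝ, E) x).symm (extChartAt 𝓘(ℝ, E) x x)) : E →L[ℝ] E →L[ℝ] ℝ)
        ((mfderiv 𝓘(ℝ, E) 𝓘(ℝ, E) (extChartAt 𝓘(ℝ, E) x).symm (extChartAt 𝓘(ℝ, E) x x) :
          E →L[ℝ] E) a)
        ((mfderiv 𝓘(ℝ, E) 𝓘(ℝ, E) (extChartAt 𝓘(ℝ, E) x).symm (extChartAt 𝓘(ℝ, E) x x) :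
          E →L[ℝ] E) b) := rfl
  rw [h3, ← h2 _ (extChartAt_to_inv (I := 𝓘(ℝ, E)) x)]
  have h4 : ∀ w : E, (mfderiv 𝓘(ℝ, E) 𝓘(ℝ, E) (extChartAt 𝓘(ℝ, E) x).symm
      (extChartAt 𝓘(ℝ, E) x x) : E →L[ℝ] E) w = w := fun w => by
    have := congrArg (fun A : E →L[ℝ] E => A w) h1
    exact this
  rw [h4, h4]

lemma inner_self_nonneg {H : Type*} [TopologicalSpace H] {I : ModelWithCorners ℝ E H} {M : Type*}
    [TopologicalSpace M] [ChartedSpace H M] [IsManifold I ∞ M]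
    (g : Bundle.ContMDiffRiemannianMetric I ∞ E (fun x : M => TangentSpace I x)) (x : M)
    (y : TangentSpace I x) : 0 ≤ g.inner x y y := by
  by_cases h : y = 0
  · simp [h]
  · exact (g.pos x y h).le

lemma inner_smul_self {H : Type*} [TopologicalSpace H] {I : ModelWithCorners ℝ E H} {M : Type*}
    [TopologicalSpace M] [ChartedSpace H M] [IsManifold I ∞ M]
    (g : Bundle.ContMDiffRiemannianMetric I ∞ E (fun x : M => TangentSpace I x)) (x : M) (r : ℝ)
    (y : TangentSpace I x) : g.inner x (r • y) (r • y) = r ^ 2 * g.inner x y y := by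
  rw [map_smul, map_smul, smul_apply, smul_eq_mul, smul_eq_mul]
  ring

lemma riemannianNorm_sq {H : Type*} [TopologicalSpace H] {I : ModelWithCorners ℝ E H} {M : Type*}
    [TopologicalSpace M] [ChartedSpace H M] [IsManifold I ∞ M]
    (g : Bundle.ContMDiffRiemannianMetric I ∞ E (fun x : M => TangentSpace I x)) (x : M)
    (y : TangentSpace I x) : riemannianNorm g x y ^ 2 = g.inner x y y :=
  Real.sq_sqrt (inner_self_nonneg g x y)

lemma inChart_riemannianNorm_sq (c : M) (p v : E) :
    inChart 𝓘(ℝ, E) (riemannianNorm g) c p v ^ 2 = metricInChart g c p v v :=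
  riemannianNorm_sq g _ _

/-- The hypothesis concerns quotients on planes. The denominator is positive by strict
Cauchy–Schwarz, and dependent pairs, where no plane exists, have zero numerator. -/
lemma connectionCurvature_nonpos [FiniteDimensional ℝ E] (hg : NonposSectionalCurvature g) (x : M)
    (u v : E) : metricInChart g x (extChartAt 𝓘(ℝ, E) x x)
      (connectionCurvature (christoffelCLM (metricInChart g x)) (extChartAt 𝓘(ℝ, E) x x) u v) u
        ≤ 0 := by
  have hγ := isMetricOn_metricInChart g x
  have hp := mem_extChartAt_target (I := 𝓘(ℝ, E)) x
  set p := extChartAt 𝓘(ℝ, E) x x with hpdef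
  by_cases hv : v = 0
  · simp [hv, connectionCurvature]
  by_cases hu : ∃ c : ℝ, c • v = u
  · obtain ⟨c, rfl⟩ := hu
    simp [connectionCurvature_self]
  push Not at hu
  have hli : LinearIndependent ℝ ![u, v] := by
    rw [LinearIndependent.pair_symm_iff]
    exact (LinearIndependent.pair_iff' hv).2 hu
  have h1 := hg x u v hli
  have h2 := form_cauchySchwarz_lt (hγ.symm p hp) (hγ.pos p hp) hv hu
  have e1 : ∀ a b : E, (g.inner x : E →L[ℝ] E →L[ℝ] ℝ) a b = metricInChart g x p a b :=
    fun a b => (metricInChart_self g x a b).symm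
  change (g.inner x : E →L[ℝ] E →L[ℝ] ℝ) (curvatureCoord (E := E) (metricInChart g x) p u v v) u /
    ((g.inner x : E →L[ℝ] E →L[ℝ] ℝ) u u * (g.inner x : E →L[ℝ] E →L[ℝ] ℝ) v v -
      (g.inner x : E →L[ℝ] E →L[ℝ] ℝ) u v ^ 2) ≤ 0 at h1
  simp only [e1] at h1
  rw [hγ.curvatureCoord_eq hp, hγ.symm p hp u v] at h1
  by_contra hc
  push Not at hc
  exact absurd h1 (not_le.2 (div_pos hc (by linarith)))

end Charts

/-! ### The product metric on the product manifold -/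

section ProductCharts

variable {E₁ : Type*} [NormedAddCommGroup E₁] [NormedSpace ℝ E₁] [FiniteDimensional ℝ E₁]
  {M₁ : Type*} [TopologicalSpace M₁] [ChartedSpace E₁ M₁] [IsManifold 𝓘(ℝ, E₁) ∞ M₁]
  {E₂ : Type*} [NormedAddCommGroup E₂] [NormedSpace ℝ E₂] [FiniteDimensional ℝ E₂]
  {M₂ : Type*} [TopologicalSpace M₂] [ChartedSpace E₂ M₂] [IsManifold 𝓘(ℝ, E₂) ∞ M₂]
  (g₁ : Bundle.ContMDiffRiemannianMetric 𝓘(ℝ, E₁) ∞ E₁ (fun x : M₁ => TangentSpace 𝓘(ℝ, E₁) x))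
  (g₂ : Bundle.ContMDiffRiemannianMetric 𝓘(ℝ, E₂) ∞ E₂ (fun x : M₂ => TangentSpace 𝓘(ℝ, E₂) x))
  {f : ℝ × ℝ → ℝ}

omit [FiniteDimensional ℝ E₁] [FiniteDimensional ℝ E₂] in
lemma mfderiv_prod_chart_symm (x : M₁ × M₂) {q : E₁ × E₂}
    (hq : q ∈ (extChartAt 𝓘(ℝ, E₁) x.1).target ×ˢ (extChartAt 𝓘(ℝ, E₂) x.2).target)
    (w : E₁ × E₂) :
    (mfderiv 𝓘(ℝ, E₁ × E₂) (𝓘(ℝ, E₁).prod 𝓘(ℝ, E₂))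
      (fun q : E₁ × E₂ => ((extChartAt 𝓘(ℝ, E₁) x.1).symm q.1, (extChartAt 𝓘(ℝ, E₂) x.2).symm q.2))
      q : E₁ × E₂ →L[ℝ] E₁ × E₂) w =
      ((mfderiv 𝓘(ℝ, E₁) 𝓘(ℝ, E₁) (extChartAt 𝓘(ℝ, E₁) x.1).symm q.1 : E₁ →L[ℝ] E₁) w.1,
        (mfderiv 𝓘(ℝ, E₂) 𝓘(ℝ, E₂) (extChartAt 𝓘(ℝ, E₂) x.2).symm q.2 : E₂ →L[ℝ] E₂) w.2) := by
  have f1 : HasMFDerivAt 𝓘(ℝ, E₁ × E₂) 𝓘(ℝ, E₁) (Prod.fst : E₁ × E₂ → E₁) q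
      (ContinuousLinearMap.fst ℝ E₁ E₂) := hasFDerivAt_fst.hasMFDerivAt
  have f2 : HasMFDerivAt 𝓘(ℝ, E₁ × E₂) 𝓘(ℝ, E₂) (Prod.snd : E₁ × E₂ → E₂) q
      (ContinuousLinearMap.snd ℝ E₁ E₂) := hasFDerivAt_snd.hasMFDerivAt
  have h1 := (mdifferentiableAt_chart_symm x.1 hq.1).hasMFDerivAt.comp q f1
  have h2 := (mdifferentiableAt_chart_symm x.2 hq.2).hasMFDerivAt.comp q f2
  have h3 := (h1.prodMk h2).mfderiv
  exact congrArg (fun A : E₁ × E₂ →L[ℝ] E₁ × E₂ => A w) h3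

omit [FiniteDimensional ℝ E₁] [FiniteDimensional ℝ E₂] in
lemma productMetric_eq (x : M₁ × M₂) (y : TangentSpace (𝓘(ℝ, E₁).prod 𝓘(ℝ, E₂)) x) :
    productMetric f g₁ g₂ x y =
      Real.sqrt (f (g₁.inner x.1 y.1 y.1, g₂.inner x.2 y.2 y.2)) :=
  congrArg Real.sqrt (congrArg f
    (Prod.ext (riemannianNorm_sq g₁ x.1 y.1) (riemannianNorm_sq g₂ x.2 y.2)))

/-- The bridge from the manifold to the coordinate theory: the preferred chart of a product is the
product of charts, and the derivative of its inverse splits. -/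
lemma isProductOn_inChart (hf : IsHomogeneousProfile f) (x : M₁ × M₂) :
    IsProductOn f (metricInChart g₁ x.1) (extChartAt 𝓘(ℝ, E₁) x.1).target
      (metricInChart g₂ x.2) (extChartAt 𝓘(ℝ, E₂) x.2).target
      (inChart (𝓘(ℝ, E₁).prod 𝓘(ℝ, E₂)) (productMetric f g₁ g₂) x) where
  profile := hf
  metric₁ := isMetricOn_metricInChart g₁ x.1
  metric₂ := isMetricOn_metricInChart g₂ x.2
  eq_sqrt q hq w := by
    have key : inChart (𝓘(ℝ, E₁).prod 𝓘(ℝ, E₂)) (productMetric f g₁ g₂) x q w =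
        productMetric f g₁ g₂ ((extChartAt 𝓘(ℝ, E₁) x.1).symm q.1,
          (extChartAt 𝓘(ℝ, E₂) x.2).symm q.2)
          ((mfderiv 𝓘(ℝ, E₁ × E₂) (𝓘(ℝ, E₁).prod 𝓘(ℝ, E₂))
            (fun q : E₁ × E₂ => ((extChartAt 𝓘(ℝ, E₁) x.1).symm q.1,
              (extChartAt 𝓘(ℝ, E₂) x.2).symm q.2)) q : E₁ × E₂ →L[ℝ] E₁ × E₂) w) := by
      rw [inChart, extChartAt_prod]
      rfl
    rw [key, mfderiv_prod_chart_symm x hq]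
    exact productMetric_eq g₁ g₂ _ _

omit [FiniteDimensional ℝ E₁] [FiniteDimensional ℝ E₂] [IsManifold 𝓘(ℝ, E₁) ∞ M₁]
  [IsManifold 𝓘(ℝ, E₂) ∞ M₂] in
lemma extChartAt_prod_self_mem (x : M₁ × M₂) :
    extChartAt (𝓘(ℝ, E₁).prod 𝓘(ℝ, E₂)) x x ∈
      (extChartAt 𝓘(ℝ, E₁) x.1).target ×ˢ (extChartAt 𝓘(ℝ, E₂) x.2).target := by
  rw [extChartAt_prod]
  exact ⟨mem_extChartAt_target x.1, mem_extChartAt_target x.2⟩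

omit [FiniteDimensional ℝ E₁] [FiniteDimensional ℝ E₂] in
lemma innerPair_mem (x : M₁ × M₂) (y : TangentSpace (𝓘(ℝ, E₁).prod 𝓘(ℝ, E₂)) x) :
    (g₁.inner x.1 y.1 y.1, g₂.inner x.2 y.2 y.2) ∈ quadrant :=
  ⟨inner_self_nonneg g₁ x.1 y.1, inner_self_nonneg g₂ x.2 y.2⟩

omit [FiniteDimensional ℝ E₁] [FiniteDimensional ℝ E₂] in
lemma innerPair_ne_zero (x : M₁ × M₂) {y : TangentSpace (𝓘(ℝ, E₁).prod 𝓘(ℝ, E₂)) x}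
    (hy : y ≠ 0) : (g₁.inner x.1 y.1 y.1, g₂.inner x.2 y.2 y.2) ≠ (0 : ℝ × ℝ) := by
  intro h0
  obtain ⟨a1, a2⟩ := Prod.ext_iff.1 h0
  refine hy (Prod.ext ?_ ?_)
  · by_contra h
    exact (g₁.pos _ _ h).ne' a1
  · by_contra h
    exact (g₂.pos _ _ h).ne' a2

omit [FiniteDimensional ℝ E₁] [FiniteDimensional ℝ E₂] in
lemma contMDiffOn_productMetric (hf : IsHomogeneousProfile f) :
    ContMDiffOn (𝓘(ℝ, E₁).prod 𝓘(ℝ, E₂)).tangent 𝓘(ℝ, ℝ) ∞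
      (fun z : TangentBundle (𝓘(ℝ, E₁).prod 𝓘(ℝ, E₂)) (M₁ × M₂) =>
        productMetric f g₁ g₂ z.proj z.snd) {z | z.snd ≠ 0} := by
  set Z := TangentBundle (𝓘(ℝ, E₁).prod 𝓘(ℝ, E₂)) (M₁ × M₂)
  -- The identification of the tangent bundle of the product with the product of tangent bundles
  -- makes both component projections smooth, hence also both squared norms.
  have hZ := contMDiff_equivTangentBundleProd (I := 𝓘(ℝ, E₁)) (M := M₁) (I' := 𝓘(ℝ, E₂))
    (M' := M₂) (n := ∞)
  have e1 := (contMDiff_fst.comp hZ).contMDiffOn (s := Set.univ)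
  have e2 := (contMDiff_snd.comp hZ).contMDiffOn (s := Set.univ)
  have h1 := contMDiffOn_univ.1 (contMDiffOn_inner g₁ (b := fun z : Z => z.proj.1)
    (v := fun z : Z => z.snd.1) (w := fun z : Z => z.snd.1) e1 e1)
  have h2 := contMDiffOn_univ.1 (contMDiffOn_inner g₂ (b := fun z : Z => z.proj.2)
    (v := fun z : Z => z.snd.2) (w := fun z : Z => z.snd.2) e2 e2)
  intro z hz
  have hnn := fun z : Z => innerPair_mem g₁ g₂ z.proj z.snd
  have hq0 := innerPair_ne_zero g₁ g₂ z.proj hz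
  have h3 : ContDiffWithinAt ℝ ∞ (fun q => Real.sqrt (f q)) quadrant _ :=
    (hf.smoothOffOrigin _ (hnn z) hq0).sqrt (hf.pos (hnn z) hq0).ne'
  have h4 := ContMDiffWithinAt.comp z (t := quadrant) h3.contMDiffWithinAt
    ((h1.prodMk_space h2).contMDiffAt.contMDiffWithinAt (s := {z : Z | z.snd ≠ 0}) (x := z))
    (fun z _ => hnn z)
  refine h4.congr (fun z _ => productMetric_eq g₁ g₂ _ _) (productMetric_eq g₁ g₂ _ _)

lemma isFinslerMetric_productMetric (hf : IsHomogeneousProfile f) (hc : ConvexityConditions f) :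
    IsFinslerMetric (𝓘(ℝ, E₁).prod 𝓘(ℝ, E₂)) (productMetric f g₁ g₂) where
  nonneg x y := Real.sqrt_nonneg _
  eq_zero_iff x y := by
    refine (productMetric_eq g₁ g₂ x y).congr_left.trans
      ((Real.sqrt_eq_zero (hf.nonneg _ (innerPair_mem g₁ g₂ x y))).trans ⟨fun h0 => ?_, ?_⟩)
    · by_contra hy
      exact hf.ne_zero _ (innerPair_mem g₁ g₂ x y) (innerPair_ne_zero g₁ g₂ x hy) h0
    · rintro rfl
      refine Eq.trans (congrArg f (Prod.ext ?_ ?_)) hf.map_zero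
      · exact ContinuousLinearMap.map_zero _
      · exact ContinuousLinearMap.map_zero _
  homogeneous x y r hr := by
    have h3 := hf.homogeneous _ (innerPair_mem g₁ g₂ x y) (r ^ 2) (by positivity)
    have h4 : productMetric f g₁ g₂ x (r • y) =
        Real.sqrt (f (r ^ 2 • (g₁.inner x.1 y.1 y.1, g₂.inner x.2 y.2 y.2))) :=
      (productMetric_eq g₁ g₂ x (r • y)).trans
        (congrArg Real.sqrt (congrArg f (Prod.ext
          (inner_smul_self g₁ x.1 r y.1) (inner_smul_self g₂ x.2 r y.2))))
    rw [h4, h3, Real.sqrt_mul (sq_nonneg r), Real.sqrt_sq hr.le]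
    exact congrArg (r * ·) (productMetric_eq g₁ g₂ x y).symm
  smooth := contMDiffOn_productMetric g₁ g₂ hf
  posDef x y u hy hu := by
    have h := isProductOn_inChart g₁ g₂ hf x
    have hp := extChartAt_prod_self_mem (E₁ := E₁) (E₂ := E₂) x
    exact (h.productForm_self_pos hc hp hy hu).trans_eq (h.fundCoord_apply hp hy u u).symm

/-- The numerator combines two nonpositive terms with the positive weights `f_s` and `f_t`; the
denominator is nonnegative by Cauchy–Schwarz for `g_y`. -/
lemma nonposFlagCurvature_productMetric (hf : IsHomogeneousProfile f)
    (hc : ConvexityConditions f) (h₁ : NonposSectionalCurvature g₁)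
    (h₂ : NonposSectionalCurvature g₂) :
    NonposFlagCurvature (𝓘(ℝ, E₁).prod 𝓘(ℝ, E₂)) (productMetric f g₁ g₂) := by
  intro x y u hyu
  have h := isProductOn_inChart g₁ g₂ hf x
  have hp := extChartAt_prod_self_mem (E₁ := E₁) (E₂ := E₂) x
  have hy : y ≠ 0 := hyu.ne_zero 0
  obtain ⟨c1, c2, -⟩ := hc _ (h.normPair_mem hp y) (h.normPair_ne_zero hp hy)
  have hpos : ∀ a : E₁ × E₂, a ≠ 0 → 0 < fundCoord (inChart (𝓘(ℝ, E₁).prod 𝓘(ℝ, E₂))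
      (productMetric f g₁ g₂) x) (extChartAt (𝓘(ℝ, E₁).prod 𝓘(ℝ, E₂)) x x) y a a := fun a ha =>
    (h.productForm_self_pos hc hp hy ha).trans_eq (h.fundCoord_apply hp hy a a).symm
  have hsymm : ∀ a b : E₁ × E₂, fundCoord (inChart (𝓘(ℝ, E₁).prod 𝓘(ℝ, E₂))
      (productMetric f g₁ g₂) x) (extChartAt (𝓘(ℝ, E₁).prod 𝓘(ℝ, E₂)) x x) y a b =
      fundCoord (inChart (𝓘(ℝ, E₁).prod 𝓘(ℝ, E₂))
      (productMetric f g₁ g₂) x) (extChartAt (𝓘(ℝ, E₁).prod 𝓘(ℝ, E₂)) x x) y b a := fun a b =>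
    ((h.fundCoord_apply hp hy a b).trans (h.productForm_comm hp y a b)).trans
      (h.fundCoord_apply hp hy b a).symm
  have hnum := h.fundCoord_riemannCoord_self hc hp hy u
  have e : extChartAt (𝓘(ℝ, E₁).prod 𝓘(ℝ, E₂)) x x =
      (extChartAt 𝓘(ℝ, E₁) x.1 x.1, extChartAt 𝓘(ℝ, E₂) x.2 x.2) := by rw [extChartAt_prod]; rfl
  have k₁ := connectionCurvature_nonpos g₁ h₁ x.1 (u : E₁ × E₂).1 (y : E₁ × E₂).1
  have k₂ := connectionCurvature_nonpos g₂ h₂ x.2 (u : E₁ × E₂).2 (y : E₁ × E₂).2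
  have e₁ : (extChartAt (𝓘(ℝ, E₁).prod 𝓘(ℝ, E₂)) x x).1 = extChartAt 𝓘(ℝ, E₁) x.1 x.1 := by
    rw [e]
  have e₂ : (extChartAt (𝓘(ℝ, E₁).prod 𝓘(ℝ, E₂)) x x).2 = extChartAt 𝓘(ℝ, E₂) x.2 x.2 := by
    rw [e]
  rw [← e₁] at k₁
  rw [← e₂] at k₂
  refine div_nonpos_of_nonpos_of_nonneg (hnum.trans_le ?_)
    (sub_nonneg.2 (form_cauchySchwarz hsymm hpos y u))
  exact add_nonpos (mul_nonpos_of_nonneg_of_nonpos c1.le k₁)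
    (mul_nonpos_of_nonneg_of_nonpos c2.le k₂)

lemma hasRigidity_productMetric (hf : IsHomogeneousProfile f) (hc : ConvexityConditions f) :
    HasRigidity (𝓘(ℝ, E₁).prod 𝓘(ℝ, E₂)) (productMetric f g₁ g₂) where
  meanLandsberg_eq_zero x y u hy :=
    (isProductOn_inChart g₁ g₂ hf x).meanLandsbergCoord_eq_zero hc
      (extChartAt_prod_self_mem (E₁ := E₁) (E₂ := E₂) x) hy u
  linearIndependent x y hy hI :=
    (isProductOn_inChart g₁ g₂ hf x).linearIndependent_meanCartan hc
      (extChartAt_prod_self_mem (E₁ := E₁) (E₂ := E₂) x) hy hI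
  flagCurvature_eq_zero x y hy _ := by
    have h := (isProductOn_inChart g₁ g₂ hf x).riemannCoord_meanCartan hc
      (extChartAt_prod_self_mem (E₁ := E₁) (E₂ := E₂) x) hy
    have h1 : riemann (𝓘(ℝ, E₁).prod 𝓘(ℝ, E₂)) (productMetric f g₁ g₂) x y
      (meanCartan (𝓘(ℝ, E₁).prod 𝓘(ℝ, E₂)) (productMetric f g₁ g₂) x y) = 0 := h
    rw [flagCurvature, h1, map_zero, zero_apply, zero_div]

end ProductCharts

end Finsler

end

/-! ### The main theorem -/

theorem mainTheorem7
    {E₁ : Type*} [NormedAddCommGroup E₁] [NormedSpace ℝ E₁] [FiniteDimensional ℝ E₁]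
    {M₁ : Type*} [TopologicalSpace M₁] [ChartedSpace E₁ M₁] [IsManifold 𝓘(ℝ, E₁) ∞ M₁]
    {E₂ : Type*} [NormedAddCommGroup E₂] [NormedSpace ℝ E₂] [FiniteDimensional ℝ E₂]
    {M₂ : Type*} [TopologicalSpace M₂] [ChartedSpace E₂ M₂] [IsManifold 𝓘(ℝ, E₂) ∞ M₂]
    (g₁ : Bundle.ContMDiffRiemannianMetric 𝓘(ℝ, E₁) ∞ E₁
      (fun x : M₁ => TangentSpace 𝓘(ℝ, E₁) x))
    (g₂ : Bundle.ContMDiffRiemannianMetric 𝓘(ℝ, E₂) ∞ E₂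
      (fun x : M₂ => TangentSpace 𝓘(ℝ, E₂) x))
    (f : ℝ × ℝ → ℝ) (hf : Finsler.IsHomogeneousProfile f) :
    -- positive definiteness of the fundamental tensor is equivalent to the conditions on `f`
    (Nontrivial E₁ → Nontrivial E₂ → Nonempty M₁ → Nonempty M₂ →
      ((∀ (x : M₁ × M₂) (y u : TangentSpace (𝓘(ℝ, E₁).prod 𝓘(ℝ, E₂)) x), y ≠ 0 → u ≠ 0 →
          0 < Finsler.fundamentalTensor (𝓘(ℝ, E₁).prod 𝓘(ℝ, E₂))
            (Finsler.productMetric f g₁ g₂) x y u u) ↔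
        Finsler.ConvexityConditions f)) ∧
    (Finsler.ConvexityConditions f →
      Finsler.IsFinslerMetric (𝓘(ℝ, E₁).prod 𝓘(ℝ, E₂)) (Finsler.productMetric f g₁ g₂) ∧
      -- the spray coefficients and the Riemann tensor are direct sums
      (∀ (x : M₁ × M₂) (y : TangentSpace (𝓘(ℝ, E₁).prod 𝓘(ℝ, E₂)) x), y ≠ 0 →
        Finsler.spray (𝓘(ℝ, E₁).prod 𝓘(ℝ, E₂)) (Finsler.productMetric f g₁ g₂) x y =
          (Finsler.spray 𝓘(ℝ, E₁) (Finsler.riemannianNorm g₁) x.1 y.1,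
            Finsler.spray 𝓘(ℝ, E₂) (Finsler.riemannianNorm g₂) x.2 y.2)) ∧
      Finsler.IsBerwald (𝓘(ℝ, E₁).prod 𝓘(ℝ, E₂)) (Finsler.productMetric f g₁ g₂) ∧
      (∀ (x : M₁ × M₂) (y v : TangentSpace (𝓘(ℝ, E₁).prod 𝓘(ℝ, E₂)) x), y ≠ 0 →
        Finsler.riemann (𝓘(ℝ, E₁).prod 𝓘(ℝ, E₂)) (Finsler.productMetric f g₁ g₂) x y v =
          (Finsler.riemann 𝓘(ℝ, E₁) (Finsler.riemannianNorm g₁) x.1 y.1 v.1,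
            Finsler.riemann 𝓘(ℝ, E₂) (Finsler.riemannianNorm g₂) x.2 y.2 v.2)) ∧
      -- nonpositive curvature passes to the product metric
      (Finsler.NonposSectionalCurvature g₁ → Finsler.NonposSectionalCurvature g₂ →
        Finsler.NonposFlagCurvature (𝓘(ℝ, E₁).prod 𝓘(ℝ, E₂))
          (Finsler.productMetric f g₁ g₂)) ∧
      -- `g_y(R_y(I_y), I_y) = 0`
      (∀ (x : M₁ × M₂) (y : TangentSpace (𝓘(ℝ, E₁).prod 𝓘(ℝ, E₂)) x), y ≠ 0 →
        Finsler.fundamentalTensor (𝓘(ℝ, E₁).prod 𝓘(ℝ, E₂)) (Finsler.productMetric f g₁ g₂) x y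
          (Finsler.riemann (𝓘(ℝ, E₁).prod 𝓘(ℝ, E₂)) (Finsler.productMetric f g₁ g₂) x y
            (Finsler.meanCartan (𝓘(ℝ, E₁).prod 𝓘(ℝ, E₂)) (Finsler.productMetric f g₁ g₂) x y))
          (Finsler.meanCartan (𝓘(ℝ, E₁).prod 𝓘(ℝ, E₂))
            (Finsler.productMetric f g₁ g₂) x y) = 0) ∧
      -- vanishing S-curvature; the hypotheses and conclusions of the rigidity theorem
      (∀ (x : M₁ × M₂) (y : TangentSpace (𝓘(ℝ, E₁).prod 𝓘(ℝ, E₂)) x), y ≠ 0 →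
        Finsler.sCurvature (𝓘(ℝ, E₁).prod 𝓘(ℝ, E₂)) (Finsler.productMetric f g₁ g₂) x y = 0) ∧
      (CompactSpace M₁ → CompactSpace M₂ →
        Finsler.NonposSectionalCurvature g₁ → Finsler.NonposSectionalCurvature g₂ →
        Finsler.IsCompactNonposConstantS (𝓘(ℝ, E₁).prod 𝓘(ℝ, E₂))
          (Finsler.productMetric f g₁ g₂)) ∧
      Finsler.HasRigidity (𝓘(ℝ, E₁).prod 𝓘(ℝ, E₂)) (Finsler.productMetric f g₁ g₂)) := by
  refine ⟨fun _ _ ⟨x₁⟩ ⟨x₂⟩ => ⟨fun hpos => ?_, fun hc => ?_⟩, fun hc => ?_⟩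
  · have h := Finsler.isProductOn_inChart g₁ g₂ hf (x₁, x₂)
    have hp := Finsler.extChartAt_prod_self_mem (E₁ := E₁) (E₂ := E₂) (x₁, x₂)
    refine h.convexityConditions hp fun v u hv hu => ?_
    rw [← h.fundCoord_apply hp hv]
    exact hpos (x₁, x₂) v u hv hu
  · exact (Finsler.isFinslerMetric_productMetric g₁ g₂ hf hc).posDef
  have hF := Finsler.isFinslerMetric_productMetric g₁ g₂ hf hc
  have hprod := fun x : M₁ × M₂ => Finsler.isProductOn_inChart g₁ g₂ hf x
  have hmem := fun x : M₁ × M₂ => Finsler.extChartAt_prod_self_mem (E₁ := E₁) (E₂ := E₂) x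
  have hsq₁ := fun x : M₁ => fun q (_ : q ∈ (extChartAt 𝓘(ℝ, E₁) x).target) w =>
    Finsler.inChart_riemannianNorm_sq g₁ x q w
  have hsq₂ := fun x : M₂ => fun q (_ : q ∈ (extChartAt 𝓘(ℝ, E₂) x).target) w =>
    Finsler.inChart_riemannianNorm_sq g₂ x q w
  have hm₁ := fun x : M₁ => Finsler.isMetricOn_metricInChart g₁ x
  have hm₂ := fun x : M₂ => Finsler.isMetricOn_metricInChart g₂ x
  have hS : ∀ (x : M₁ × M₂) (y : TangentSpace (𝓘(ℝ, E₁).prod 𝓘(ℝ, E₂)) x), y ≠ 0 →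
      Finsler.sCurvature (𝓘(ℝ, E₁).prod 𝓘(ℝ, E₂)) (Finsler.productMetric f g₁ g₂) x y = 0 :=
    fun x y hy => (hprod x).sCurvatureCoord_eq_zero hc (hmem x) hy
  refine ⟨hF, fun x y hy => ?_, fun x => ?_, fun x y v hy => ?_,
    Finsler.nonposFlagCurvature_productMetric g₁ g₂ hf hc, fun x y hy => ?_, hS,
    -- The constant in `S = (n + 1) c F` is `c = 0`.
    fun _ _ h₁ h₂ => ⟨inferInstance, inferInstance, hF, ⟨0, fun x y hy => ?_⟩,
      Finsler.nonposFlagCurvature_productMetric g₁ g₂ hf hc h₁ h₂⟩,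
    Finsler.hasRigidity_productMetric g₁ g₂ hf hc⟩
  · have e₁ := (hm₁ x.1).sprayCoord_eq (hsq₁ x.1) (mem_extChartAt_target x.1) (y : E₁ × E₂).1
    have e₂ := (hm₂ x.2).sprayCoord_eq (hsq₂ x.2) (mem_extChartAt_target x.2) (y : E₁ × E₂).2
    have e := (hprod x).sprayCoord_eq hc (hmem x) hy
    refine (e.trans (congrArg ((1 / 2 : ℝ) • ·)
      (Finsler.prodChristoffel_apply _ _ _ _ _))).trans (Prod.ext ?_ ?_)
    · exact e₁.symm
    · exact e₂.symm
  · refine ⟨(ContinuousLinearMap.coeLM ℝ ∘ₗ (Finsler.prodChristoffel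
      (Finsler.metricInChart g₁ x.1) (Finsler.metricInChart g₂ x.2)
      (extChartAt (𝓘(ℝ, E₁).prod 𝓘(ℝ, E₂)) x x)).toLinearMap :
        E₁ × E₂ →ₗ[ℝ] E₁ × E₂ →ₗ[ℝ] E₁ × E₂), fun y hy => ?_⟩
    exact (hprod x).sprayCoord_eq hc (hmem x) hy
  · have e₁ := (hm₁ x.1).riemannCoord_eq (hsq₁ x.1) (mem_extChartAt_target x.1) (y : E₁ × E₂).1
      (v : E₁ × E₂).1
    have e₂ := (hm₂ x.2).riemannCoord_eq (hsq₂ x.2) (mem_extChartAt_target x.2) (y : E₁ × E₂).2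
      (v : E₁ × E₂).2
    have e := (hprod x).riemannCoord_eq hc (hmem x) hy v
    refine e.trans (Prod.ext ?_ ?_)
    · exact e₁.symm
    · exact e₂.symm
  · have h := (hprod x).riemannCoord_meanCartan hc (hmem x) hy
    have h1 : Finsler.riemann (𝓘(ℝ, E₁).prod 𝓘(ℝ, E₂)) (Finsler.productMetric f g₁ g₂) x y
      (Finsler.meanCartan (𝓘(ℝ, E₁).prod 𝓘(ℝ, E₂)) (Finsler.productMetric f g₁ g₂) x y) = 0 := h
    rw [h1, map_zero, zero_apply]
  · rw [hS x y hy, mul_zero, zero_mul]
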